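/- Let $n\ge 2$. For $z\in\mathbb C$ let $\operatorname{Arg}_{[0,\pi)}z$ be $\operatorname{Arg} z$ if $\operatorname{Im}z>0$, $0$ if $z\in\mathbb R$, and $\pi+\operatorname{Arg} z$ if $\operatorname{Im}z<0$, where $\operatorname{Arg}\in(-\pi,\pi]$ is the principal argument. Let $\mathcal J$ be the $n\times n$ Jacobi matrix with diagonal entries $b_1,\dots,b_n\in\mathbb R$ and off-diagonal entries $a_1,\dots,a_{n-1}>0$ (so $\mathcal J_{j,j+1}=\mathcal J_{j+1,j}=a_j$), and for $l\in\mathbb R$, $m>0$ let $\mathcal J_{l,m}$ be the matrix obtained from $\mathcal J$ by replacing the $(1,1)$-entry with $b_1+il$ and the $(2,1)$-entry with $a_1+im$. Spectra are multisets of eigenvalues counted with algebraic multiplicity. For $\xi\in\mathbb R$ let $\mathcal C_\xi$ be the set of all multisets $\{z_j\}_{j=1}^n$ of points of $\mathbb C\setminus\mathbb R$ with $$\sum_{j=1}^n \operatorname{Arg}_{[0,\pi)}(z_j-\xi)<\frac{\pi}{2}.$$ (1) Let $\mathcal J$, $l\in\mathbb R$ and $m>0$ be given, put $\xi=b_1-\frac{l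 a_1}{m}$, and suppose $\det(\mathcal J-\xi I)\neq 0$. Then the spectrum of $\mathcal J_{l,m}$ belongs to $\mathcal C_\xi$. Moreover, the number of eigenvalues of $\mathcal J$ greater than $\xi$ equals the number of eigenvalues of $\mathcal J_{l,m}$ in the open upper half-plane, and the number of eigenvalues of $\mathcal J$ less than $\xi$ equals the number of eigenvalues of $\mathcal J_{l,m}$ in the open lower half-plane. (2) Conversely, let $\xi\in\mathbb R$. For each configuration in $\mathcal C_\xi$ there is exactly one choice of a Jacobi matrix $\mathcal J$ and numbers $l\in\mathbb R$, $m>0$ with $b_1-\frac{l a_1}{m}=\xi$ such that the configuration is the spectrum of $\mathcal J_{l,m}$; and for this choice $\det(\mathcal J-\xi I)\ne0$. -/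

import Mathlib

/-- The argument of a complex number modulo `π`, with values in `[0, π)`. -/
noncomputable def argModPi (z : ℂ) : ℝ :=
  if 0 < z.im then Complex.arg z
  else if z.im < 0 then Real.pi + Complex.arg z
  else 0

/-- The tridiagonal symmetric matrix of size `n + 1` with diagonal entries `b` and
off-diagonal entries `a`. It is a Jacobi matrix when all `a i` are positive. -/
def jacobiMatrix {n : ℕ} (a : Fin n → ℝ) (b : Fin (n + 1) → ℝ) :
    Matrix (Fin (n + 1)) (Fin (n + 1)) ℝ :=
  Matrix.of fun i j =>
    if i = j then b i
    else if h : (i : ℕ) + 1 = (j : ℕ) then a ⟨i, by omega⟩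
    else if h : (j : ℕ) + 1 = (i : ℕ) then a ⟨j, by omega⟩
    else 0

/-- The rank-two perturbation of a Jacobi matrix of size `n + 2`: the (complex) matrix obtained by
adding `i l` to the top left entry and `i m` to the entry below it. -/
noncomputable def perturbedJacobi {n : ℕ} (a : Fin (n + 1) → ℝ) (b : Fin (n + 2) → ℝ) (l m : ℝ) :
    Matrix (Fin (n + 2)) (Fin (n + 2)) ℂ :=
  (jacobiMatrix a b).map (fun x : ℝ => (x : ℂ))
    + Matrix.single 0 0 (Complex.I * (l : ℂ)) + Matrix.single 1 0 (Complex.I * (m : ℂ))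

/-- The spectrum of a square matrix, as the multiset of its eigenvalues in the base field counted
with algebraic multiplicity. -/
noncomputable def eigenvalueMultiset {K : Type*} [Field K] {n : ℕ} (M : Matrix (Fin n) (Fin n) K) :
    Multiset K :=
  M.charpoly.roots

/-- Configurations (multisets) of `n` non-real points whose arguments modulo `π`, measured from the
real point `ξ`, have sum less than `π / 2`. -/
def admissibleConfigurations (n : ℕ) (ξ : ℝ) : Set (Multiset ℂ) :=
  {s | Multiset.card s = n ∧ (∀ z ∈ s, z.im ≠ 0) ∧
    (s.map fun z => argModPi (z - (ξ : ℂ))).sum < Real.pi / 2}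

/-! The characteristic polynomial of the perturbed matrix is `P = p + iB`, where `p` belongs to the
Jacobi matrix, `q` to its truncation without the first row and column, and `B = k (p - (X - ξ) q)`
with `k = m / a 0 > 0`. At a root `r` of `p` interlacing gives `p' q > 0`, so `p' B` has the sign of
`ξ - r`; moreover `B(ξ) = k p(ξ)`.

Both directions rest on the phase `φ(x) = ∑ arg (x - z)` over the zeros `z` of `P`. It is continuous
on the real line, tends to `0` at `+∞`, and equals `S - πU` at `ξ`, where `S` is the sum of the
arguments modulo `π` and `U` counts the zeros in the upper half-plane. The roots of `p` are the
points where `φ` is an odd multiple of `π/2`, and `φ` increases where `p' B < 0`.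

Direct problem (`IsReImPair.count_of_sign`): to the right of `ξ` every such level is crossed
upwards, hence at most once, so `K > 0` roots there force `(K - 1/2)π < πU - S` and `K ≤ U`.
Reflection at `ξ` treats the left side. The totals agree, so both counts are equalities, and the
bound then reads `S < π/2`.

Inverse problem (`IsReImPair.sign_of_sum_lt`): if `S < π/2`, then `φ(ξ)` lies below `U` levels, each
crossed to the right of `ξ`; with the reflected statement this produces all roots of `p`, with the
required signs. Since `0 < S < π/2`, also `p(ξ) B(ξ) > 0`, so `k = B(ξ) / p(ξ)` and `q` are
recovered from `P`. They interlace, and an interlacing pair comes from exactly one Jacobi matrix by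
the Euclidean algorithm (`exists_jacobiPair_eq`, `jacobiPair_injective`). -/

open Polynomial Filter Topology

/-! ### Phase and amplitude of a configuration on the real line -/

/-- The sum of the principal arguments of `x - z` over the points `z` of a configuration. -/
noncomputable def phase (s : Multiset ℂ) (x : ℝ) : ℝ :=
  (s.map fun z => Complex.arg ((x : ℂ) - z)).sum

/-- The product of the distances from `x` to the points of a configuration. -/
noncomputable def amplitude (s : Multiset ℂ) (x : ℝ) : ℝ :=
  (s.map fun z => ‖(x : ℂ) - z‖).prod

/-- `A` and `B` are the real and imaginary parts on the real line of the monic polynomial with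
root multiset `s`. -/
def IsReImPair (s : Multiset ℂ) (A B : ℝ[X]) : Prop :=
  ∀ x : ℝ, (s.map fun z => (x : ℂ) - z).prod =
    ((A.eval x : ℝ) : ℂ) + ((B.eval x : ℝ) : ℂ) * Complex.I

theorem sub_mem_slitPlane {z : ℂ} (hz : z.im ≠ 0) (x : ℝ) : (x : ℂ) - z ∈ Complex.slitPlane := by
  right
  simpa using hz

theorem continuous_phase {s : Multiset ℂ} (hs : ∀ z ∈ s, z.im ≠ 0) : Continuous (phase s) := by
  unfold phase
  refine continuous_multiset_sum _ fun z hz => ?_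
  rw [continuous_iff_continuousAt]
  intro x
  exact (Complex.continuousAt_arg (sub_mem_slitPlane (hs z hz) x)).comp
    (f := fun x : ℝ => (x : ℂ) - z) (by fun_prop)

theorem amplitude_pos {s : Multiset ℂ} (hs : ∀ z ∈ s, z.im ≠ 0) (x : ℝ) : 0 < amplitude s x := by
  unfold amplitude
  refine Multiset.prod_pos fun y hy => ?_
  obtain ⟨z, hz, rfl⟩ := Multiset.mem_map.1 hy
  exact norm_pos_iff.2 (Complex.slitPlane_ne_zero (sub_mem_slitPlane (hs z hz) x))

theorem prod_eq_amplitude_mul_exp (s : Multiset ℂ) (x : ℝ) :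
    (s.map fun z => (x : ℂ) - z).prod = amplitude s x * Complex.exp (phase s x * Complex.I) := by
  unfold amplitude phase
  induction s using Multiset.induction_on with
  | empty => simp
  | cons z s ih =>
    simp only [Multiset.map_cons, Multiset.prod_cons, Multiset.sum_cons, ih]
    push_cast
    rw [add_mul, Complex.exp_add]
    nth_rewrite 1 [← Complex.norm_mul_exp_arg_mul_I ((x : ℂ) - z)]
    ring

theorem tendsto_phase_atTop (s : Multiset ℂ) :
    Tendsto (phase s) atTop (𝓝 0) := by
  have h : ∀ z : ℂ, Tendsto (fun x : ℝ => Complex.arg ((x : ℂ) - z)) atTop (𝓝 0) := by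
    intro z
    -- The argument is unchanged by positive scaling, and `x - z = x (1 - z / x)` for `x > 0`.
    have h1 : Tendsto (fun x : ℝ => Complex.arg (1 - (x⁻¹ : ℝ) * z)) atTop (𝓝 0) := by
      have h2 : Tendsto (fun x : ℝ => (1 : ℂ) - (x⁻¹ : ℝ) * z) atTop (𝓝 1) := by
        have h3 : Tendsto (fun x : ℝ => ((x⁻¹ : ℝ) : ℂ)) atTop (𝓝 ((0 : ℝ) : ℂ)) :=
          (Complex.continuous_ofReal.tendsto _).comp tendsto_inv_atTop_zero
        simpa using (h3.mul_const z).const_sub 1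
      simpa [Function.comp_def] using
        (Complex.continuousAt_arg (x := 1) (by simp)).tendsto.comp h2
    refine h1.congr' ?_
    filter_upwards [eventually_gt_atTop 0] with x hx
    rw [← Complex.arg_real_mul (1 - (x⁻¹ : ℝ) * z) hx]
    congr 1
    have : (x : ℂ) ≠ 0 := by exact_mod_cast hx.ne'
    push_cast
    field_simp
  have := tendsto_multiset_sum (f := fun (z : ℂ) (x : ℝ) => Complex.arg ((x : ℂ) - z))
    (x := atTop) (a := fun _ => 0) s (fun z _ => h z)
  simpa [show phase s = fun x : ℝ => (s.map fun z => Complex.arg ((x : ℂ) - z)).sum from rfl]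
    using this

/-- A point of the lower half-plane contributes the same to both sums, since negation adds `π` to
its argument; a point of the upper half-plane loses `π`. -/
theorem phase_eq {s : Multiset ℂ} (hs : ∀ z ∈ s, z.im ≠ 0) (ξ : ℝ) :
    phase s ξ = (s.map fun z => argModPi (z - (ξ : ℂ))).sum
      - Real.pi * (s.countP fun z => 0 < z.im) := by
  unfold phase
  induction s using Multiset.induction_on with
  | empty => simp
  | cons z s ih =>
    simp only [Multiset.mem_cons, forall_eq_or_imp] at hs
    rw [Multiset.map_cons, Multiset.sum_cons, ih hs.2, Multiset.map_cons, Multiset.sum_cons,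
      Multiset.countP_cons, ← neg_sub z (ξ : ℂ)]
    rcases lt_or_gt_of_ne hs.1 with h | h
    · rw [Complex.arg_neg_eq_arg_add_pi_of_im_neg (by simpa using h), argModPi]
      simp [h, not_lt.2 h.le]
      ring
    · rw [Complex.arg_neg_eq_arg_sub_pi_of_im_pos (by simpa using h), argModPi]
      simp [h]
      ring

theorem argModPi_sum_pos {s : Multiset ℂ} (hs : ∀ z ∈ s, z.im ≠ 0) (h0 : s ≠ 0) (ξ : ℝ) :
    0 < (s.map fun z => argModPi (z - (ξ : ℂ))).sum := by
  have key : ∀ z : ℂ, z.im ≠ 0 → 0 < argModPi (z - (ξ : ℂ)) := by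
    intro z hz
    unfold argModPi
    have him : (z - (ξ : ℂ)).im = z.im := by simp
    split_ifs with h1 h2
    · exact (Complex.arg_nonneg_iff.2 h1.le).lt_of_ne fun h =>
        h1.ne' (Complex.arg_eq_zero_iff.1 h.symm).2
    · linarith [Complex.neg_pi_lt_arg (z - (ξ : ℂ))]
    · exact absurd (le_antisymm (not_lt.1 h1) (not_lt.1 h2)) (by rwa [him])
  obtain ⟨z, hz⟩ := Multiset.exists_mem_of_ne_zero h0
  obtain ⟨t, rfl⟩ := Multiset.exists_cons_of_mem hz
  rw [Multiset.map_cons, Multiset.sum_cons]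
  refine add_pos_of_pos_of_nonneg (key z (hs z hz)) (Multiset.sum_nonneg fun y hy => ?_)
  obtain ⟨w, hw, rfl⟩ := Multiset.mem_map.1 hy
  exact (key w (hs w (Multiset.mem_cons_of_mem hw))).le

/-! ### Crossings of the phase at the roots of the real part -/

section

variable {s : Multiset ℂ} {A B : ℝ[X]}

theorem IsReImPair.re (h : IsReImPair s A B) (x : ℝ) :
    A.eval x = amplitude s x * Real.cos (phase s x) := by
  have := congrArg Complex.re ((h x).symm.trans (prod_eq_amplitude_mul_exp s x))
  simpa [Complex.exp_ofReal_mul_I_re] using this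

theorem IsReImPair.im (h : IsReImPair s A B) (x : ℝ) :
    B.eval x = amplitude s x * Real.sin (phase s x) := by
  have := congrArg Complex.im ((h x).symm.trans (prod_eq_amplitude_mul_exp s x))
  simpa [Complex.exp_ofReal_mul_I_im] using this

theorem IsReImPair.cos_eq_zero_iff (h : IsReImPair s A B) (hs : ∀ z ∈ s, z.im ≠ 0) (x : ℝ) :
    Real.cos (phase s x) = 0 ↔ A.eval x = 0 := by
  rw [h.re, mul_eq_zero, or_iff_right (amplitude_pos hs x).ne']

theorem IsReImPair.im_ne_zero (h : IsReImPair s A B) (hs : ∀ z ∈ s, z.im ≠ 0) {x : ℝ}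
    (hx : A.eval x = 0) : B.eval x ≠ 0 := by
  rw [h.im]
  refine mul_ne_zero (amplitude_pos hs x).ne' fun h0 => ?_
  have := Real.sin_sq_add_cos_sq (phase s x)
  rw [h0, (h.cos_eq_zero_iff hs x).2 hx] at this
  norm_num at this

/-- Turns the sign of `A` near its root `r` into the sign of the phase difference, as long as that
difference is below `π` in absolute value. -/
theorem IsReImPair.eval_mul_eval (h : IsReImPair s A B) (hs : ∀ z ∈ s, z.im ≠ 0) {r : ℝ}
    (hr : A.eval r = 0) (x : ℝ) :
    A.eval x * B.eval r =
      -(amplitude s x * amplitude s r * Real.sin (phase s x - phase s r)) := by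
  have hc := (h.cos_eq_zero_iff hs r).2 hr
  have hq := Real.sin_sq_add_cos_sq (phase s r)
  rw [h.re, h.im, Real.sin_sub, hc]
  ring

/-- At a root of `A` where `A' B < 0` the phase is strictly increasing. -/
theorem IsReImPair.eventually_phase_lt (h : IsReImPair s A B) (hs : ∀ z ∈ s, z.im ≠ 0) {r : ℝ}
    (hr : A.eval r = 0) (hd : A.derivative.eval r * B.eval r < 0) :
    ∀ᶠ x in 𝓝[≠] r, 0 < (x - r) * (phase s x - phase s r) := by
  have h1 := (hasDerivAt_iff_tendsto_slope.1 (A.hasDerivAt r)).mul_const (B.eval r)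
  have h2 : ∀ᶠ x in 𝓝[≠] r, |phase s x - phase s r| < Real.pi := by
    refine eventually_nhdsWithin_of_eventually_nhds ?_
    have : Tendsto (fun x => |phase s x - phase s r|) (𝓝 r) (𝓝 0) := by
      have := (((continuous_phase hs).sub (continuous_const (y := phase s r))).abs).tendsto r
      simpa using this
    exact this.eventually_lt_const Real.pi_pos
  filter_upwards [h1.eventually_lt_const hd, h2, self_mem_nhdsWithin] with x hx hp hne
  have hne : x - r ≠ 0 := sub_ne_zero.2 hne
  rw [slope_def_field, hr, sub_zero, div_mul_eq_mul_div, h.eval_mul_eval hs hr] at hx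
  have hpos := mul_pos (amplitude_pos hs x) (amplitude_pos hs r)
  obtain ⟨hp1, hp2⟩ := abs_lt.1 hp
  rcases lt_or_gt_of_ne hne with hlt | hgt
  · refine mul_pos_of_neg_of_neg hlt ?_
    by_contra! hge
    have := Real.sin_nonneg_of_nonneg_of_le_pi hge hp2.le
    exact absurd hx (not_lt.2 (div_nonneg_of_nonpos (by nlinarith) hlt.le))
  · refine mul_pos hgt ?_
    by_contra! hge
    have := Real.sin_nonpos_of_nonpos_of_neg_pi_le hge hp1.le
    exact absurd hx (not_lt.2 (div_nonneg (by nlinarith) hgt.le))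

/-- If the phase stays above its value at a root of `A` on the right, then `A' B ≤ 0` there. -/
theorem IsReImPair.derivative_mul_nonpos (h : IsReImPair s A B) (hs : ∀ z ∈ s, z.im ≠ 0) {r : ℝ}
    (hr : A.eval r = 0) (hd : ∀ x, r < x → phase s r < phase s x) :
    A.derivative.eval r * B.eval r ≤ 0 := by
  have h1 := (hasDerivAt_iff_tendsto_slope.1 (A.hasDerivAt r)).mul_const (B.eval r)
  have h3 : Tendsto (fun x => slope (fun x => eval x A) r x * eval r B) (𝓝[>] r)
      (𝓝 (A.derivative.eval r * B.eval r)) :=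
    h1.mono_left (nhdsWithin_mono _ fun x hx => ne_of_gt hx)
  have h2 : ∀ᶠ x in 𝓝[>] r, |phase s x - phase s r| < Real.pi := by
    refine eventually_nhdsWithin_of_eventually_nhds ?_
    have : Tendsto (fun x => |phase s x - phase s r|) (𝓝 r) (𝓝 0) := by
      have := (((continuous_phase hs).sub (continuous_const (y := phase s r))).abs).tendsto r
      simpa using this
    exact this.eventually_lt_const Real.pi_pos
  refine le_of_tendsto h3 ?_
  filter_upwards [h2, self_mem_nhdsWithin] with x hp hx
  have hx : r < x := hx
  rw [slope_def_field, hr, sub_zero, div_mul_eq_mul_div, h.eval_mul_eval hs hr]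
  have hpos := mul_pos (amplitude_pos hs x) (amplitude_pos hs r)
  have := Real.sin_nonneg_of_nonneg_of_le_pi (sub_pos.2 (hd x hx)).le (abs_lt.1 hp).2.le
  exact div_nonpos_of_nonpos_of_nonneg (by nlinarith) (sub_pos.2 hx).le

/-- Every odd multiple of `π / 2` between the phase at `ξ` and the limit `0` at infinity is attained
at a root of `A` where `A' B ≤ 0`. -/
theorem IsReImPair.exists_root_of_phase_lt (h : IsReImPair s A B) (hs : ∀ z ∈ s, z.im ≠ 0) {ξ : ℝ}
    (i : ℕ) (hi : phase s ξ < -(Real.pi / 2 + i * Real.pi)) :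
    ∃ r, ξ < r ∧ A.eval r = 0 ∧ phase s r = -(Real.pi / 2 + i * Real.pi) ∧
      A.derivative.eval r * B.eval r ≤ 0 := by
  set c : ℝ := -(Real.pi / 2 + i * Real.pi) with hc
  have hpi := Real.pi_pos
  have hc0 : c < 0 := by
    have : 0 ≤ (i : ℝ) * Real.pi := by positivity
    linarith
  have hcont := continuous_phase hs
  obtain ⟨M, hM⟩ := (((tendsto_phase_atTop s).eventually_const_lt hc0).and
    (eventually_ge_atTop ξ)).exists_forall_of_atTop
  have hξM : ξ ≤ M := (hM M le_rfl).2
  have hK : IsCompact (Set.Icc ξ M ∩ phase s ⁻¹' {c}) :=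
    isCompact_Icc.inter_right (isClosed_singleton.preimage hcont)
  obtain ⟨y, hy, hyc⟩ := intermediate_value_Icc hξM hcont.continuousOn
    (show c ∈ Set.Icc _ _ from ⟨hi.le, (hM M le_rfl).1.le⟩)
  -- The last crossing of the level `c`: since the phase ends above `c`, it can never return to `c`
  -- or below after `r`.
  obtain ⟨r, ⟨hr, hrc⟩, hmax⟩ := hK.exists_isGreatest ⟨y, hy, hyc⟩
  have hrc : phase s r = c := hrc
  have hA : A.eval r = 0 := by
    rw [← h.cos_eq_zero_iff hs, hrc, hc, Real.cos_neg, Real.cos_add_nat_mul_pi, Real.cos_pi_div_two,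
      mul_zero]
  refine ⟨r, lt_of_le_of_ne hr.1 ?_, hA, hrc, h.derivative_mul_nonpos hs hA ?_⟩
  · rintro rfl
    exact hi.ne hrc
  · intro x hx
    rw [hrc]
    by_contra! hle
    have hxM : x ≤ M := by
      by_contra! hlt
      exact absurd (hM x hlt.le).1 (not_lt.2 hle)
    obtain ⟨w, hw, hwc⟩ := intermediate_value_Icc hxM hcont.continuousOn
      (show c ∈ Set.Icc _ _ from ⟨hle, (hM M le_rfl).1.le⟩)
    have := hmax ⟨⟨hr.1.trans (hx.le.trans hw.1), hw.2⟩, hwc⟩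
    linarith [hw.1]

/-- If `A' B < 0` at all roots of `A` to the right of `ξ`, then the phase exceeds its value at such a
root everywhere to the right of that root. -/
theorem IsReImPair.phase_lt_of_root_lt (h : IsReImPair s A B) (hs : ∀ z ∈ s, z.im ≠ 0) {ξ : ℝ}
    (hd : ∀ x, ξ < x → A.eval x = 0 → A.derivative.eval x * B.eval x < 0) {r : ℝ} (hr : ξ < r)
    (hA : A.eval r = 0) {x : ℝ} (hx : r < x) : phase s r < phase s x := by
  by_contra! hle
  have hcont := continuous_phase hs
  have hright := (h.eventually_phase_lt hs hA (hd r hr hA)).filter_mono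
    (nhdsWithin_mono r fun y (hy : y ∈ Set.Ioi r) => ne_of_gt hy)
  obtain ⟨u, hu, hur⟩ := (mem_nhdsGT_iff_exists_Ioo_subset' hx).1 hright
  have hu : r < u := hu
  have habove : ∀ y, r < y → y < u → phase s r < phase s y := fun y hy hyu =>
    sub_pos.1 (pos_of_mul_pos_right (hur ⟨hy, hyu⟩) (sub_pos.2 hy).le)
  have hux : u ≤ x := by
    by_contra! hlt
    exact absurd (habove x hx hlt) (not_lt.2 hle)
  have hK : IsCompact (Set.Icc u x ∩ phase s ⁻¹' Set.Iic (phase s r)) :=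
    isCompact_Icc.inter_right (isClosed_Iic.preimage hcont)
  -- The first return to the level of `r`. It is again a root of `A`, reached from above, although
  -- the phase must increase there.
  obtain ⟨w, ⟨hw, hwc⟩, hmin⟩ := hK.exists_isLeast ⟨x, ⟨hux, le_rfl⟩, hle⟩
  have hwc : phase s w ≤ phase s r := hwc
  have hrw : r < w := hu.trans_le hw.1
  have hbelow : ∀ y, r < y → y < w → phase s r < phase s y := by
    intro y hy hyw
    by_contra! hy'
    rcases lt_or_ge y u with hyu | hyu
    · exact absurd (habove y hy hyu) (not_lt.2 hy')
    · exact absurd (hmin ⟨⟨hyu, hyw.le.trans hw.2⟩, hy'⟩) (not_le.2 hyw)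
  have hwe : phase s w = phase s r := by
    refine le_antisymm hwc (ge_of_tendsto (hcont.continuousWithinAt (s := Set.Iio w)).tendsto ?_)
    filter_upwards [Ioo_mem_nhdsLT hrw] with y hy using (hbelow y hy.1 hy.2).le
  have hAw : A.eval w = 0 := by
    rw [← h.cos_eq_zero_iff hs, hwe, h.cos_eq_zero_iff hs, hA]
  have hleft := (h.eventually_phase_lt hs hAw (hd w (hr.trans hrw) hAw)).filter_mono
    (nhdsWithin_mono w fun y (hy : y ∈ Set.Iio w) => ne_of_lt hy)
  obtain ⟨y, hy1, hy2⟩ := (hleft.and (Ioo_mem_nhdsLT hrw)).exists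
  have := hbelow y hy2.1 hy2.2
  have := neg_of_mul_pos_right hy1 (sub_neg.2 hy2.2).le
  linarith

/-- Otherwise the phase starts strictly above its value at `r`, yet is below it just left of `r`. It
then crosses that level at an earlier root, after which it should stay above. -/
theorem IsReImPair.phase_lt_of_lt_root (h : IsReImPair s A B) (hs : ∀ z ∈ s, z.im ≠ 0) {ξ : ℝ}
    (hd : ∀ x, ξ < x → A.eval x = 0 → A.derivative.eval x * B.eval x < 0) (h0 : A.eval ξ ≠ 0)
    {r : ℝ} (hr : ξ < r) (hA : A.eval r = 0) : phase s ξ < phase s r := by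
  have hcont := continuous_phase hs
  by_contra! hle
  have hlt : phase s r < phase s ξ := hle.lt_of_ne fun he => h0 <| by
    rw [← h.cos_eq_zero_iff hs, ← he, h.cos_eq_zero_iff hs, hA]
  have hleft := (h.eventually_phase_lt hs hA (hd r hr hA)).filter_mono
    (nhdsWithin_mono r fun y (hy : y ∈ Set.Iio r) => ne_of_lt hy)
  obtain ⟨y, hy1, hy2⟩ := (hleft.and (Ioo_mem_nhdsLT hr)).exists
  have hy3 := neg_of_mul_pos_right hy1 (sub_neg.2 hy2.2).le
  obtain ⟨w, hw, hwc⟩ := intermediate_value_Ioo' hy2.1.le hcont.continuousOn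
    (show phase s r ∈ Set.Ioo _ _ from ⟨by linarith, hlt⟩)
  have hAw : A.eval w = 0 := by
    rw [← h.cos_eq_zero_iff hs, hwc, h.cos_eq_zero_iff hs, hA]
  exact absurd (h.phase_lt_of_root_lt hs hd hw.1 hAw (hw.2.trans hy2.2)) (by rw [hwc]; exact lt_irrefl _)

end

/-! ### Reflection at `ξ`, which exchanges the two sides of `ξ` and the two half-planes -/

theorem argModPi_neg (z : ℂ) : argModPi (-z) = argModPi z := by
  unfold argModPi
  rcases lt_trichotomy z.im 0 with h | h | h
  · simp [h, not_lt.2 h.le, Complex.arg_neg_eq_arg_add_pi_of_im_neg h, add_comm]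
  · simp [h]
  · simp [h, not_lt.2 h.le, Complex.arg_neg_eq_arg_sub_pi_of_im_pos h]

theorem argModPi_sum_reflect (s : Multiset ℂ) (ξ : ℝ) :
    ((s.map fun z => 2 * (ξ : ℂ) - z).map fun z => argModPi (z - (ξ : ℂ))).sum =
      (s.map fun z => argModPi (z - (ξ : ℂ))).sum := by
  rw [Multiset.map_map]
  congr 1
  refine Multiset.map_congr rfl fun z _ => ?_
  rw [Function.comp_apply, ← argModPi_neg]
  congr 1
  ring

theorem countP_reflect (s : Multiset ℂ) (ξ : ℝ) :
    (s.map fun z => 2 * (ξ : ℂ) - z).countP (fun z => 0 < z.im) = s.countP fun z => z.im < 0 := by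
  rw [Multiset.countP_map, Multiset.countP_eq_card_filter]
  simp

theorem countP_add_countP {s : Multiset ℂ} (hs : ∀ z ∈ s, z.im ≠ 0) :
    (s.countP fun z => 0 < z.im) + (s.countP fun z => z.im < 0) = Multiset.card s := by
  rw [Multiset.card_eq_countP_add_countP (fun z : ℂ => 0 < z.im)]
  congr 1
  refine Multiset.countP_congr rfl fun z hz => ?_
  simpa using (hs z hz).le_iff_lt.symm

theorem reflect_im_ne_zero {s : Multiset ℂ} (hs : ∀ z ∈ s, z.im ≠ 0) (ξ : ℝ) :
    ∀ z ∈ s.map (fun z => 2 * (ξ : ℂ) - z), z.im ≠ 0 := by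
  intro z hz
  obtain ⟨w, hw, rfl⟩ := Multiset.mem_map.1 hz
  simpa using hs w hw

/-- The polynomial whose values are those of `A` reflected at `ξ`, up to the sign `(-1) ^ N`. -/
noncomputable def reflectPoly (N : ℕ) (ξ : ℝ) (A : ℝ[X]) : ℝ[X] :=
  C ((-1) ^ N) * A.comp (C (2 * ξ) - X)

theorem eval_reflectPoly (N : ℕ) (ξ : ℝ) (A : ℝ[X]) (x : ℝ) :
    (reflectPoly N ξ A).eval x = (-1) ^ N * A.eval (2 * ξ - x) := by
  simp [reflectPoly]

theorem eval_derivative_reflectPoly (N : ℕ) (ξ : ℝ) (A : ℝ[X]) (x : ℝ) :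
    (reflectPoly N ξ A).derivative.eval x = -((-1) ^ N * A.derivative.eval (2 * ξ - x)) := by
  rw [reflectPoly, derivative_C_mul]
  simp [derivative_comp]

theorem eval_reflectPoly_eq_zero {N : ℕ} {ξ : ℝ} {A : ℝ[X]} {x : ℝ} :
    (reflectPoly N ξ A).eval x = 0 ↔ A.eval (2 * ξ - x) = 0 := by
  rw [eval_reflectPoly, mul_eq_zero, or_iff_right (pow_ne_zero _ (by norm_num))]

theorem eval_derivative_mul_reflectPoly (N : ℕ) (ξ : ℝ) (A B : ℝ[X]) (x : ℝ) :
    (reflectPoly N ξ A).derivative.eval x * (reflectPoly N ξ B).eval x =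
      -(A.derivative.eval (2 * ξ - x) * B.eval (2 * ξ - x)) := by
  rw [eval_derivative_reflectPoly, eval_reflectPoly]
  have : ((-1 : ℝ) ^ N) * (-1) ^ N = 1 := by rw [← mul_pow]; simp
  linear_combination (-(A.derivative.eval (2 * ξ - x) * B.eval (2 * ξ - x))) * this

/-! ### Root counts and the sum of arguments modulo `π` -/

section

variable {s : Multiset ℂ} {A B : ℝ[X]}

/-- Each factor satisfies `x - (2ξ - z) = -((2ξ - x) - z)`, whence the sign `(-1) ^ card s`. -/
theorem IsReImPair.reflect (h : IsReImPair s A B) (ξ : ℝ) :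
    IsReImPair (s.map fun z => 2 * (ξ : ℂ) - z) (reflectPoly (Multiset.card s) ξ A)
      (reflectPoly (Multiset.card s) ξ B) := by
  intro x
  have h1 := h (2 * ξ - x)
  rw [Multiset.map_map, eval_reflectPoly, eval_reflectPoly]
  have h2 : (s.map ((fun z : ℂ => (x : ℂ) - z) ∘ fun z => 2 * (ξ : ℂ) - z)).prod =
      (-1) ^ Multiset.card s * (s.map fun z => ((2 * ξ - x : ℝ) : ℂ) - z).prod := by
    have : (-1 : ℂ) ^ Multiset.card s = (s.map fun _ => (-1 : ℂ)).prod := by simp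
    rw [this, ← Multiset.prod_map_mul]
    congr 1
    refine Multiset.map_congr rfl fun z _ => ?_
    simp only [Function.comp_apply]
    push_cast
    ring
  rw [h2, h1]
  push_cast
  ring

/-- If `A' B < 0` at all roots of `A` to the right of `ξ`, then the number of these roots is bounded
by the increase of the phase from `ξ` to infinity. -/
theorem IsReImPair.card_lt_of_roots (h : IsReImPair s A B) (hs : ∀ z ∈ s, z.im ≠ 0) {ξ : ℝ}
    (hd : ∀ x, ξ < x → A.eval x = 0 → A.derivative.eval x * B.eval x < 0) (h0 : A.eval ξ ≠ 0)
    {T : Finset ℝ} (hT : ∀ r ∈ T, ξ < r ∧ A.eval r = 0) (hne : T.Nonempty) :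
    ((T.card : ℝ) - 1 / 2) * Real.pi < -phase s ξ := by
  have hpi := Real.pi_pos
  -- The phase at a root is an odd multiple of `π / 2`, and it is nonpositive because it stays below
  -- later values, which tend to `0`.
  have hlevel : ∀ r ∈ T, ∃ i : ℕ, phase s r = -(Real.pi / 2 + i * Real.pi) := by
    intro r hr
    obtain ⟨hr, hA⟩ := hT r hr
    have hcos := (h.cos_eq_zero_iff hs r).2 hA
    have hle : phase s r ≤ 0 := by
      refine ge_of_tendsto (tendsto_phase_atTop s) ?_
      filter_upwards [eventually_gt_atTop r] with x hx
      exact (h.phase_lt_of_root_lt hs hd hr hA hx).le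
    obtain ⟨k, hk⟩ := Real.cos_eq_zero_iff.1 hcos
    have hk1 : k ≤ -1 := by
      by_contra! hlt
      have : (0 : ℝ) ≤ k := by exact_mod_cast (by omega : (0 : ℤ) ≤ k)
      have : 0 < (2 * (k : ℝ) + 1) * Real.pi / 2 := by positivity
      linarith
    obtain ⟨i, hi⟩ := Int.eq_ofNat_of_zero_le (show 0 ≤ -k - 1 by omega)
    refine ⟨i, ?_⟩
    have : (k : ℝ) = -(i : ℝ) - 1 := by exact_mod_cast (by omega : k = -(i : ℤ) - 1)
    rw [hk, this]
    ring
  choose! f hf using hlevel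
  have hinj : Set.InjOn f T := by
    intro x hx y hy hxy
    have hp : phase s x = phase s y := by rw [hf x hx, hf y hy, hxy]
    rcases lt_trichotomy x y with hlt | heq | hgt
    · exact absurd hp (h.phase_lt_of_root_lt hs hd (hT x hx).1 (hT x hx).2 hlt).ne
    · exact heq
    · exact absurd hp (h.phase_lt_of_root_lt hs hd (hT y hy).1 (hT y hy).2 hgt).ne'
  -- Distinct roots have distinct levels in `ℕ`, so some level is at least `T.card - 1`.
  obtain ⟨r, hr, hcard⟩ : ∃ r ∈ T, T.card ≤ f r + 1 := by
    by_contra! hlt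
    have h1 : (T.image f).card = T.card := Finset.card_image_of_injOn hinj
    have h2 : T.image f ⊆ Finset.range (T.card - 1) := by
      intro i hi
      obtain ⟨r, hr, rfl⟩ := Finset.mem_image.1 hi
      have := hlt r hr
      exact Finset.mem_range.2 (by omega)
    have h3 := Finset.card_le_card h2
    rw [h1, Finset.card_range] at h3
    have := hne.card_pos
    omega
  have h1 := h.phase_lt_of_lt_root hs hd h0 (hT r hr).1 (hT r hr).2
  rw [hf r hr] at h1
  have h2 : (T.card : ℝ) ≤ f r + 1 := by exact_mod_cast hcard
  nlinarith

/-- If `A` has as many roots as `s` has points and `A' B` has the sign of `ξ - r` at each root `r`,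
then the arguments modulo `π` of `s` add up to less than `π / 2`, and the roots of `A` on both sides
of `ξ` are as many as the points of `s` in the two half-planes. -/
theorem IsReImPair.count_of_sign (h : IsReImPair s A B) (hs : ∀ z ∈ s, z.im ≠ 0) {ξ : ℝ}
    (hs0 : s ≠ 0) (hcard : Multiset.card A.roots = Multiset.card s) (hnodup : A.roots.Nodup)
    (h0 : A.eval ξ ≠ 0)
    (hd : ∀ r, A.eval r = 0 → A.derivative.eval r * B.eval r * (r - ξ) < 0) :
    (s.map fun z => argModPi (z - (ξ : ℂ))).sum < Real.pi / 2 ∧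
      (A.roots.countP (fun x => ξ < x) = s.countP fun z => 0 < z.im) ∧
      (A.roots.countP (fun x => x < ξ) = s.countP fun z => z.im < 0) := by
  have hpi := Real.pi_pos
  have hA0 : A ≠ 0 := by rintro rfl; simp at h0
  have hroot : ∀ r, r ∈ A.roots ↔ A.eval r = 0 := fun r => mem_roots hA0
  have hd1 : ∀ x, ξ < x → A.eval x = 0 → A.derivative.eval x * B.eval x < 0 := fun x hx hA =>
    neg_of_mul_neg_left (hd x hA) (sub_pos.2 hx).le
  have hUL := countP_add_countP hs
  have hroots : A.roots.countP (fun x => ξ < x) + A.roots.countP (fun x => x < ξ) =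
      Multiset.card s := by
    rw [← hcard, Multiset.card_eq_countP_add_countP (fun x : ℝ => ξ < x)]
    congr 1
    refine Multiset.countP_congr rfl fun x hx => ?_
    have : x ≠ ξ := by
      rintro rfl
      exact h0 ((hroot _).1 hx)
    simpa using this.le_iff_lt.symm
  have hS := argModPi_sum_pos hs hs0 ξ
  have hphase := phase_eq hs ξ
  have hphase' := phase_eq (reflect_im_ne_zero hs ξ) ξ
  rw [argModPi_sum_reflect, countP_reflect] at hphase'
  have hpos : 0 < A.roots.countP (fun x => ξ < x) →
      ((A.roots.countP (fun x => ξ < x) : ℝ) - 1 / 2) * Real.pi < -phase s ξ := by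
    intro hlt
    have hT : (A.roots.toFinset.filter fun x => ξ < x).card = A.roots.countP (fun x => ξ < x) := by
      rw [Multiset.countP_eq_card_filter, ← Multiset.toFinset_filter,
        Multiset.toFinset_card_of_nodup (hnodup.filter _)]
    rw [← hT] at hlt ⊢
    refine h.card_lt_of_roots hs hd1 h0 (fun r hr => ?_) (Finset.card_pos.1 hlt)
    rw [Finset.mem_filter, Multiset.mem_toFinset, hroot] at hr
    exact hr.symm
  have hneg : 0 < A.roots.countP (fun x => x < ξ) →
      ((A.roots.countP (fun x => x < ξ) : ℝ) - 1 / 2) * Real.pi <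
        -phase (s.map fun z => 2 * (ξ : ℂ) - z) ξ := by
    intro hlt
    have hT : ((A.roots.toFinset.filter fun x => x < ξ).image fun x => 2 * ξ - x).card =
        A.roots.countP (fun x => x < ξ) := by
      rw [Finset.card_image_of_injective _ (sub_right_injective), Multiset.countP_eq_card_filter,
        ← Multiset.toFinset_filter, Multiset.toFinset_card_of_nodup (hnodup.filter _)]
    rw [← hT] at hlt ⊢
    refine (h.reflect ξ).card_lt_of_roots (reflect_im_ne_zero hs ξ) ?_ ?_ (fun r hr => ?_)
      (Finset.card_pos.1 hlt)
    · intro x hx hA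
      rw [eval_reflectPoly_eq_zero] at hA
      rw [eval_derivative_mul_reflectPoly]
      have := hd _ hA
      nlinarith
    · rw [Ne, eval_reflectPoly_eq_zero]
      rwa [show 2 * ξ - ξ = ξ by ring]
    · rw [Finset.mem_image] at hr
      obtain ⟨x, hx, rfl⟩ := hr
      rw [Finset.mem_filter, Multiset.mem_toFinset, hroot] at hx
      refine ⟨by linarith [hx.2], ?_⟩
      rw [eval_reflectPoly_eq_zero, show 2 * ξ - (2 * ξ - x) = x by ring]
      exact hx.1
  rw [hphase] at hpos
  rw [hphase'] at hneg
  generalize (s.map fun z => argModPi (z - (ξ : ℂ))).sum = S at *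
  generalize (s.countP fun z => 0 < z.im) = U at *
  generalize (s.countP fun z => z.im < 0) = V at *
  generalize A.roots.countP (fun x => ξ < x) = K at *
  generalize A.roots.countP (fun x => x < ξ) = K' at *
  have hN : 0 < Multiset.card s := Multiset.card_pos.2 hs0
  have hsum : (K : ℝ) + K' = U + V := by exact_mod_cast hroots.trans hUL.symm
  have hle : ∀ a b : ℕ, ((a : ℝ) - 1 / 2) * Real.pi < -(S - Real.pi * b) → a ≤ b := by
    intro a b hab
    by_contra! hlt
    have : (b : ℝ) + 1 ≤ a := by exact_mod_cast hlt
    nlinarith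
  have hKU : K ≤ U := by
    rcases K.eq_zero_or_pos with h | h
    · omega
    · exact hle _ _ (hpos h)
  have hKV : K' ≤ V := by
    rcases K'.eq_zero_or_pos with h | h
    · omega
    · exact hle _ _ (hneg h)
  have hKU' : K = U := by omega
  have hKV' : K' = V := by omega
  refine ⟨?_, hKU', hKV'⟩
  subst hKU' hKV'
  -- As `s` is nonempty, at least one side of `ξ` carries a root; its bound, with equal counts,
  -- becomes `S < π / 2`.
  rcases K.eq_zero_or_pos with h | h
  · have := hneg (by omega)
    nlinarith
  · have := hpos h
    nlinarith

/-- If the arguments modulo `π` of `s` add up to less than `π / 2`, then `A` has simple real roots,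
and `A' B` has the sign of `ξ - r` at each root `r`. -/
theorem IsReImPair.sign_of_sum_lt (h : IsReImPair s A B) (hs : ∀ z ∈ s, z.im ≠ 0) {ξ : ℝ}
    (hA0 : A ≠ 0) (hdeg : A.natDegree ≤ Multiset.card s)
    (hS : (s.map fun z => argModPi (z - (ξ : ℂ))).sum < Real.pi / 2) :
    A.roots.Nodup ∧ Multiset.card A.roots = Multiset.card s ∧
      ∀ r, A.eval r = 0 → A.derivative.eval r * B.eval r * (r - ξ) < 0 := by
  have hpi := Real.pi_pos
  have hphase := phase_eq hs ξ
  have hphase' := phase_eq (reflect_im_ne_zero hs ξ) ξ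
  rw [argModPi_sum_reflect, countP_reflect] at hphase'
  have hUL := countP_add_countP hs
  have hpos : ∀ i : Fin (s.countP fun z => 0 < z.im), ∃ r, ξ < r ∧ A.eval r = 0 ∧
      phase s r = -(Real.pi / 2 + (i : ℕ) * Real.pi) ∧
      A.derivative.eval r * B.eval r ≤ 0 := by
    intro i
    refine h.exists_root_of_phase_lt hs i ?_
    have : ((i : ℕ) : ℝ) + 1 ≤ (s.countP fun z => 0 < z.im : ℕ) := by exact_mod_cast i.2
    rw [hphase]
    nlinarith
  have hneg : ∀ i : Fin (s.countP fun z => z.im < 0), ∃ r, r < ξ ∧ A.eval r = 0 ∧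
      phase (s.map fun z => 2 * (ξ : ℂ) - z) (2 * ξ - r) =
        -(Real.pi / 2 + (i : ℕ) * Real.pi) ∧
      0 ≤ A.derivative.eval r * B.eval r := by
    intro i
    obtain ⟨r, h1, h2, h3, h4⟩ := (h.reflect ξ).exists_root_of_phase_lt (reflect_im_ne_zero hs ξ)
      (ξ := ξ) i (by
        have : ((i : ℕ) : ℝ) + 1 ≤ (s.countP fun z => z.im < 0 : ℕ) := by exact_mod_cast i.2
        rw [hphase']
        nlinarith)
    rw [eval_reflectPoly_eq_zero] at h2
    rw [eval_derivative_mul_reflectPoly] at h4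
    refine ⟨2 * ξ - r, by linarith, h2, ?_, by linarith⟩
    rw [← h3]
    congr 1
    ring
  choose f hf1 hf2 hf3 hf4 using hpos
  choose g hg1 hg2 hg3 hg4 using hneg
  have hlevel : ∀ i j : ℕ, -(Real.pi / 2 + (i : ℝ) * Real.pi) = -(Real.pi / 2 + (j : ℝ) * Real.pi) →
      i = j := by
    intro i j hij
    have : (i : ℝ) * Real.pi = j * Real.pi := by linarith
    exact_mod_cast mul_right_cancel₀ hpi.ne' this
  have hfinj : Function.Injective f := fun i j hij =>
    Fin.ext (hlevel _ _ (by rw [← hf3, ← hf3, hij]))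
  have hginj : Function.Injective g := fun i j hij =>
    Fin.ext (hlevel _ _ (by rw [← hg3, ← hg3, hij]))
  set T : Finset ℝ := Finset.univ.image f ∪ Finset.univ.image g with hT
  have hTcard : T.card = Multiset.card s := by
    rw [hT, Finset.card_union_of_disjoint, Finset.card_image_of_injective _ hfinj,
      Finset.card_image_of_injective _ hginj, Finset.card_fin, Finset.card_fin, hUL]
    rw [Finset.disjoint_left]
    intro x hx hx'
    obtain ⟨i, -, rfl⟩ := Finset.mem_image.1 hx
    obtain ⟨j, -, hj⟩ := Finset.mem_image.1 hx'
    linarith [hf1 i, hg1 j]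
  have hTroots : T.val ≤ A.roots := by
    rw [Multiset.le_iff_subset T.nodup]
    intro x hx
    rw [mem_roots hA0, IsRoot.def]
    replace hx : x ∈ T := hx
    rcases Finset.mem_union.1 hx with hx | hx <;> obtain ⟨i, -, rfl⟩ := Finset.mem_image.1 hx
    · exact hf2 i
    · exact hg2 i
  -- The degree leaves no room for further roots or multiplicities beyond `T`.
  have hle : Multiset.card A.roots ≤ Multiset.card T.val := by
    rw [Finset.card_val, hTcard]
    exact (card_roots' A).trans hdeg
  have hTeq : T.val = A.roots := Multiset.eq_of_le_of_card_le hTroots hle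
  have hnodup : A.roots.Nodup := hTeq ▸ T.nodup
  refine ⟨hnodup, by rw [← hTeq, Finset.card_val, hTcard], fun r hr => ?_⟩
  have hderiv : A.derivative.eval r ≠ 0 := by
    intro hd
    have h1 := (one_lt_rootMultiplicity_iff_isRoot hA0).2 ⟨hr, hd⟩
    have h2 := Multiset.nodup_iff_count_le_one.1 hnodup r
    rw [count_roots] at h2
    omega
  -- Makes the weak signs obtained at the crossings strict.
  have hprod : A.derivative.eval r * B.eval r ≠ 0 := mul_ne_zero hderiv (h.im_ne_zero hs hr)
  have hrT : r ∈ T := by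
    rw [← Finset.mem_val, hTeq, mem_roots hA0]
    exact hr
  rcases Finset.mem_union.1 hrT with hx | hx <;> obtain ⟨i, -, rfl⟩ := Finset.mem_image.1 hx
  · exact mul_neg_of_neg_of_pos ((hf4 i).lt_of_ne hprod) (sub_pos.2 (hf1 i))
  · exact mul_neg_of_pos_of_neg ((hg4 i).lt_of_ne' hprod) (sub_neg.2 (hg1 i))

/-- The phase at `ξ` is congruent modulo `π` to the sum of the arguments, which lies in `(0, π /
2)`; the product of sine and cosine is unaffected by shifts by `π`. -/
theorem IsReImPair.eval_mul_pos (h : IsReImPair s A B) (hs : ∀ z ∈ s, z.im ≠ 0) {ξ : ℝ}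
    (hs0 : s ≠ 0) (hS : (s.map fun z => argModPi (z - (ξ : ℂ))).sum < Real.pi / 2) :
    0 < A.eval ξ * B.eval ξ := by
  have hS0 := argModPi_sum_pos hs hs0 ξ
  set S := (s.map fun z => argModPi (z - (ξ : ℂ))).sum
  have h1 : 0 < Real.sin S := Real.sin_pos_of_pos_of_lt_pi hS0 (by linarith [Real.pi_pos])
  have h2 : 0 < Real.cos S := Real.cos_pos_of_mem_Ioo ⟨by linarith, hS⟩
  have h3 := amplitude_pos hs ξ
  have h4 : ∀ n : ℕ, ((-1 : ℝ) ^ n) * (-1) ^ n = 1 := fun n => by rw [← mul_pow]; simp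
  rw [h.re, h.im, phase_eq hs, mul_comm Real.pi, Real.sin_sub_nat_mul_pi, Real.cos_sub_nat_mul_pi]
  have : ∀ a c d e : ℝ, e * e = 1 → a * (e * c) * (a * (e * d)) = a * a * (c * d) := by
    intro a c d e he
    linear_combination (a * a * c * d) * he
  rw [this _ _ _ _ (h4 _)]
  positivity

end

/-! ### Partial fractions with positive residues -/

/-- A partial fraction expansion: if `p = ∏ (X - r)` over a finite set and `R` has smaller degree,
then `R` is a combination of the products `p / (X - r)`. -/
theorem eq_sum_prod_erase (T : Finset ℝ) {R : ℝ[X]} (hR : R.degree < T.card) :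
    R = ∑ r ∈ T, C (R.eval r / ∏ t ∈ T.erase r, (r - t)) * ∏ t ∈ T.erase r, (X - C t) := by
  refine eq_of_degree_sub_lt_of_eval_finset_eq T ?_ fun x hx => ?_
  · refine (degree_sub_le _ _).trans_lt (max_lt hR ?_)
    refine (degree_sum_le _ _).trans_lt ?_
    rw [Finset.sup_lt_iff (WithBot.bot_lt_coe _)]
    intro r hr
    refine ((degree_mul_le _ _).trans (add_le_add_left degree_C_le _)).trans_lt ?_
    rw [zero_add, degree_prod]
    simp only [degree_X_sub_C, Finset.sum_const, Finset.card_erase_of_mem hr]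
    have := Finset.card_pos.2 ⟨r, hr⟩
    rw [nsmul_eq_mul, mul_one]
    exact_mod_cast Nat.sub_lt this one_pos
  · rw [eval_finsetSum, Finset.sum_eq_single_of_mem x hx]
    · have : ∏ t ∈ T.erase x, (x - t) ≠ 0 :=
        Finset.prod_ne_zero_iff.2 fun t ht => sub_ne_zero.2 (Finset.ne_of_mem_erase ht).symm
      rw [eval_mul, eval_C, eval_prod]
      simp only [eval_sub, eval_X, eval_C]
      rw [div_mul_cancel₀ _ this]
    · intro r hr hrx
      have : (∏ t ∈ T.erase r, (X - C t)).eval x = 0 := by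
        rw [eval_prod]
        exact Finset.prod_eq_zero (Finset.mem_erase.2 ⟨hrx.symm, hx⟩) (by simp)
      rw [eval_mul, this, mul_zero]

theorem eval_derivative_prod (T : Finset ℝ) {r : ℝ} (hr : r ∈ T) :
    (∏ t ∈ T, (X - C t)).derivative.eval r = ∏ t ∈ T.erase r, (r - t) := by
  rw [← Finset.mul_prod_erase T _ hr, derivative_mul]
  simp [eval_prod]

/-- The polynomial `R` is positively weighted on the roots of `∏ t ∈ T, (X - t)`: it has smaller
degree, and the residues of the quotient are positive. -/
structure HasPosResidues (T : Finset ℝ) (R : ℝ[X]) : Prop where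
  degree_lt : R.degree < T.card
  pos : ∀ r ∈ T, 0 < (∏ t ∈ T, (X - C t)).derivative.eval r * R.eval r

namespace HasPosResidues

variable {T : Finset ℝ} {R : ℝ[X]}

theorem weight_pos (h : HasPosResidues T R) {r : ℝ} (hr : r ∈ T) :
    0 < R.eval r / ∏ t ∈ T.erase r, (r - t) := by
  have := h.pos r hr
  rw [eval_derivative_prod T hr] at this
  exact div_pos_iff.2 (mul_pos_iff.1 (mul_comm _ (R.eval r) ▸ this))

/-- In the partial fraction expansion this coefficient is the sum of the weights. -/
theorem coeff_pos (h : HasPosResidues T R) (hT : T.Nonempty) : 0 < R.coeff (T.card - 1) := by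
  rw [eq_sum_prod_erase T h.degree_lt, finsetSum_coeff]
  refine Finset.sum_pos (fun r hr => ?_) hT
  have h1 : (∏ t ∈ T.erase r, (X - C t)).coeff (T.card - 1) = 1 := by
    have hm : (∏ t ∈ T.erase r, (X - C t)).Monic := monic_prod_X_sub_C _ _
    have hd : (∏ t ∈ T.erase r, (X - C t)).natDegree = T.card - 1 := by
      rw [natDegree_finsetProd_X_sub_C_eq_card, Finset.card_erase_of_mem hr]
    rw [← hd]
    exact hm
  rw [coeff_C_mul, h1, mul_one]
  exact h.weight_pos hr

/-- The quotient of complex values as a partial fraction. -/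
theorem aeval_div (h : HasPosResidues T R) {z : ℂ} (hz : ∀ r ∈ T, z ≠ (r : ℂ)) :
    aeval z R = (∏ t ∈ T, (z - (t : ℂ))) *
      ∑ r ∈ T, ((R.eval r / ∏ t ∈ T.erase r, (r - t) : ℝ) : ℂ) / (z - r) := by
  conv_lhs => rw [eq_sum_prod_erase T h.degree_lt]
  rw [map_sum, Finset.mul_sum]
  refine Finset.sum_congr rfl fun r hr => ?_
  have hne : z - r ≠ 0 := sub_ne_zero.2 (hz r hr)
  rw [← Finset.mul_prod_erase T _ hr, map_mul, map_prod, aeval_C]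
  simp only [map_sub, aeval_X, aeval_C, Complex.coe_algebraMap]
  field_simp

/-- Off the real axis all terms `w / (z - r)` with `w > 0` have imaginary part of the sign of
`-z.im`, so they cannot cancel. -/
theorem aeval_ne_zero (h : HasPosResidues T R) (hT : T.Nonempty) {z : ℂ} (hz : z.im ≠ 0) :
    aeval z R ≠ 0 := by
  have hzr : ∀ r : ℝ, z ≠ (r : ℂ) := by
    rintro r rfl
    exact hz (Complex.ofReal_im r)
  rw [h.aeval_div fun r _ => hzr r]
  refine mul_ne_zero (Finset.prod_ne_zero_iff.2 fun t _ => sub_ne_zero.2 (hzr t)) fun h0 => ?_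
  have him := congrArg Complex.im h0
  rw [Complex.im_sum, Complex.zero_im] at him
  have hterm : ∀ r ∈ T, (((R.eval r / ∏ t ∈ T.erase r, (r - t) : ℝ) : ℂ) / (z - r)).im =
      -z.im * ((R.eval r / ∏ t ∈ T.erase r, (r - t)) / Complex.normSq (z - r)) := by
    intro r _
    rw [Complex.div_im]
    simp only [Complex.ofReal_im, Complex.ofReal_re, Complex.sub_im]
    ring
  rw [Finset.sum_congr rfl hterm, ← Finset.mul_sum, mul_eq_zero,
    or_iff_right (neg_ne_zero.2 hz)] at him
  exact him.not_gt (Finset.sum_pos (fun r hr => div_pos (h.weight_pos hr)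
    (Complex.normSq_pos.2 (sub_ne_zero.2 (hzr r)))) hT)

/-- With `p` the product, `R / p = ∑ w / (x - r)` has derivative `-∑ w / (x - r) ^ 2 < 0`; at a zero
of `R` this derivative is `R' / p`. -/
theorem derivative_mul_neg (h : HasPosResidues T R) (hT : T.Nonempty) {x : ℝ}
    (hx : R.eval x = 0) :
    R.derivative.eval x * (∏ t ∈ T, (X - C t)).eval x < 0 := by
  have hxT : ∀ r ∈ T, x - r ≠ 0 := by
    intro r hr h0
    have := h.pos r hr
    rw [← sub_eq_zero.1 h0, hx, mul_zero] at this
    exact this.false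
  set p : ℝ[X] := ∏ t ∈ T, (X - C t) with hp
  have hpx : p.eval x ≠ 0 := by
    rw [hp, eval_prod]
    exact Finset.prod_ne_zero_iff.2 fun t ht => by simpa using hxT t ht
  have hfac : ∀ r ∈ T, (∏ t ∈ T.erase r, (X - C t)).eval x = p.eval x / (x - r) := by
    intro r hr
    rw [eq_div_iff (hxT r hr), hp, ← Finset.mul_prod_erase T _ hr, eval_mul]
    simp [mul_comm]
  have hfac' : ∀ r ∈ T, (∏ t ∈ T.erase r, (X - C t)).derivative.eval x =
      p.derivative.eval x / (x - r) - p.eval x / (x - r) ^ 2 := by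
    intro r hr
    have h1 : p.derivative.eval x = (∏ t ∈ T.erase r, (X - C t)).eval x +
        (x - r) * (∏ t ∈ T.erase r, (X - C t)).derivative.eval x := by
      rw [hp, ← Finset.mul_prod_erase T _ hr, derivative_mul]
      simp
    have := hxT r hr
    rw [h1, hfac r hr]
    field_simp
    ring
  have hR : R.eval x = p.eval x *
      ∑ r ∈ T, (R.eval r / ∏ t ∈ T.erase r, (r - t)) / (x - r) := by
    conv_lhs => rw [eq_sum_prod_erase T h.degree_lt]
    rw [eval_finsetSum, Finset.mul_sum]
    refine Finset.sum_congr rfl fun r hr => ?_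
    rw [eval_mul, eval_C, hfac r hr]
    ring
  rw [hx, zero_eq_mul, or_iff_right hpx] at hR
  have hR' : R.derivative.eval x = -(p.eval x *
      ∑ r ∈ T, (R.eval r / ∏ t ∈ T.erase r, (r - t)) / (x - r) ^ 2) := by
    have h1 : R.derivative.eval x = p.derivative.eval x *
        (∑ r ∈ T, (R.eval r / ∏ t ∈ T.erase r, (r - t)) / (x - r)) - p.eval x *
        ∑ r ∈ T, (R.eval r / ∏ t ∈ T.erase r, (r - t)) / (x - r) ^ 2 := by
      conv_lhs => rw [eq_sum_prod_erase T h.degree_lt]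
      rw [derivative_sum, eval_finsetSum, Finset.mul_sum, Finset.mul_sum, ← Finset.sum_sub_distrib]
      refine Finset.sum_congr rfl fun r hr => ?_
      rw [derivative_C_mul, eval_mul, eval_C, hfac' r hr]
      ring
    rw [h1, hR, mul_zero, zero_sub]
  rw [hR']
  have hpos : 0 < ∑ r ∈ T, (R.eval r / ∏ t ∈ T.erase r, (r - t)) / (x - r) ^ 2 :=
    Finset.sum_pos (fun r hr => div_pos (h.weight_pos hr) (by have := hxT r hr; positivity)) hT
  have := mul_pos (mul_self_pos.2 hpx) hpos
  linarith

end HasPosResidues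

/-! ### Interlacing pairs and the Euclidean step -/

/-- A real polynomial without non-real roots splits over the reals. -/
theorem splits_of_aeval_ne_zero {R : ℝ[X]} (h : ∀ z : ℂ, z.im ≠ 0 → aeval z R ≠ 0) :
    R.Splits := by
  rcases eq_or_ne R 0 with rfl | hR0
  · simp
  rw [splits_iff_card_roots]
  have hc : (R.map Complex.ofRealHom).Splits := IsAlgClosed.splits _
  have hroots : (R.map Complex.ofRealHom).roots =
      ((R.map Complex.ofRealHom).roots.map Complex.re).map Complex.ofRealHom := by
    rw [Multiset.map_map]
    conv_lhs => rw [← Multiset.map_id (R.map Complex.ofRealHom).roots]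
    refine Multiset.map_congr rfl fun z hz => ?_
    have hz0 : aeval z R = 0 := by
      rw [mem_roots (by simpa using hR0), IsRoot.def, eval_map] at hz
      exact hz
    have : z.im = 0 := by
      by_contra hne
      exact h z hne hz0
    exact Complex.ext (by simp) (by simpa using this)
  have hprod : R = C R.leadingCoeff *
      (((R.map Complex.ofRealHom).roots.map Complex.re).map fun x => X - C x).prod := by
    apply Polynomial.map_injective Complex.ofRealHom Complex.ofReal_injective
    conv_lhs => rw [hc.eq_prod_roots, hroots]
    simp [Polynomial.map_multiset_prod, Multiset.map_map]
  have h1 : R.roots = (R.map Complex.ofRealHom).roots.map Complex.re := by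
    conv_lhs => rw [hprod]
    rw [roots_C_mul _ (leadingCoeff_ne_zero.2 hR0), roots_multiset_prod_X_sub_C]
  rw [h1, Multiset.card_map, ← hc.natDegree_eq_card_roots, natDegree_map]

/-- Two monic polynomials of degrees `n + 1` and `n` whose roots are real and strictly interlace. -/
structure Interlaces (n : ℕ) (p q : ℝ[X]) : Prop where
  monic_left : p.Monic
  monic_right : q.Monic
  natDegree_left : p.natDegree = n + 1
  natDegree_right : q.natDegree = n
  card_roots : Multiset.card p.roots = n + 1
  pos : ∀ x, p.eval x = 0 → 0 < p.derivative.eval x * q.eval x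

theorem nodup_roots_of_derivative_ne_zero {p : ℝ[X]} (hp : p ≠ 0)
    (h : ∀ x, p.eval x = 0 → p.derivative.eval x ≠ 0) : p.roots.Nodup := by
  rw [Multiset.nodup_iff_count_le_one]
  intro x
  rw [count_roots]
  by_contra! hlt
  obtain ⟨h1, h2⟩ := (one_lt_rootMultiplicity_iff_isRoot hp).1 hlt
  exact h x h1 h2

theorem prod_toFinset_roots {p : ℝ[X]} (hp : p.Monic) (hcard : Multiset.card p.roots = p.natDegree)
    (h : p.roots.Nodup) : ∏ t ∈ p.roots.toFinset, (X - C t) = p := by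
  rw [Finset.prod, Multiset.toFinset_val, Multiset.dedup_eq_self.2 h]
  exact prod_multiset_X_sub_C_of_monic_of_roots_card_eq hp hcard

/-- One step of the Euclidean algorithm on an interlacing pair. -/
theorem Interlaces.exists_step {n : ℕ} {p q : ℝ[X]} (h : Interlaces (n + 1) p q) :
    ∃ (a b : ℝ) (r : ℝ[X]), 0 < a ∧ Interlaces n q r ∧ p = (X - C b) * q - C (a ^ 2) * r := by
  have hp0 := h.monic_left.ne_zero
  have hq0 := h.monic_right.ne_zero
  have hpnd : p.roots.Nodup := nodup_roots_of_derivative_ne_zero hp0 fun x hx h0 => by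
    have := h.pos x hx
    rw [h0, zero_mul] at this
    exact this.false
  have hpprod := prod_toFinset_roots h.monic_left (by rw [h.card_roots, h.natDegree_left]) hpnd
  have hpcard : p.roots.toFinset.card = n + 2 := by
    rw [Multiset.toFinset_card_of_nodup hpnd, h.card_roots]
  have hpne : p.roots.toFinset.Nonempty := Finset.card_pos.1 (by omega)
  have hpq : HasPosResidues p.roots.toFinset q := by
    refine ⟨?_, fun r hr => ?_⟩
    · rw [hpcard, degree_eq_natDegree hq0, h.natDegree_right]
      exact_mod_cast Nat.lt_succ_self _
    · rw [hpprod]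
      exact h.pos r (by simpa [hp0] using hr)
  have hqsplits : q.Splits := splits_of_aeval_ne_zero fun z hz => hpq.aeval_ne_zero hpne hz
  have hqcard' : Multiset.card q.roots = n + 1 := by
    rw [splits_iff_card_roots.1 hqsplits, h.natDegree_right]
  have hqneg : ∀ x, q.eval x = 0 → q.derivative.eval x * p.eval x < 0 := by
    intro x hx
    have := hpq.derivative_mul_neg hpne hx
    rwa [hpprod] at this
  have hqnd : q.roots.Nodup := nodup_roots_of_derivative_ne_zero hq0 fun x hx h0 => by
    have := hqneg x hx
    rw [h0, zero_mul] at this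
    exact this.false
  have hqprod := prod_toFinset_roots h.monic_right (by rw [hqcard', h.natDegree_right]) hqnd
  have hqcard : q.roots.toFinset.card = n + 1 := by
    rw [Multiset.toFinset_card_of_nodup hqnd, hqcard']
  have hqne : q.roots.toFinset.Nonempty := Finset.card_pos.1 (by omega)
  -- This `b` cancels the coefficient of degree `n + 1` in `(X - b) q - p`; degree `n + 2` cancels
  -- by monicity.
  set b : ℝ := q.coeff n - p.coeff (n + 1) with hb
  set R : ℝ[X] := (X - C b) * q - p with hR
  have hRdeg : R.degree < ((n + 1 : ℕ) : WithBot ℕ) := by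
    rw [degree_lt_iff_coeff_zero]
    intro m hm
    have hqc : q.coeff (n + 1) = 1 := by rw [← h.natDegree_right]; exact h.monic_right
    have hpc : p.coeff (n + 2) = 1 := by rw [← h.natDegree_left]; exact h.monic_left
    obtain ⟨m, rfl⟩ := Nat.exists_eq_add_of_le' (show 1 ≤ m by omega)
    rw [hR, coeff_sub, sub_mul, coeff_sub, coeff_X_mul, coeff_C_mul]
    rcases (show m = n ∨ m = n + 1 ∨ n + 2 ≤ m by omega) with rfl | rfl | hm
    · rw [hqc, hb]; ring
    · rw [hqc, hpc, coeff_eq_zero_of_natDegree_lt (by rw [h.natDegree_right]; omega)]; ring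
    · rw [coeff_eq_zero_of_natDegree_lt (p := q) (by rw [h.natDegree_right]; omega),
        coeff_eq_zero_of_natDegree_lt (p := q) (by rw [h.natDegree_right]; omega),
        coeff_eq_zero_of_natDegree_lt (p := p) (by rw [h.natDegree_left]; omega)]
      ring
  have hRx : ∀ x, q.eval x = 0 → R.eval x = -p.eval x := by
    intro x hx
    simp [hR, hx]
  have hqR : HasPosResidues q.roots.toFinset R := by
    refine ⟨by rwa [hqcard], fun r hr => ?_⟩
    have hr0 : q.eval r = 0 := by simpa [hq0] using hr
    rw [hqprod, hRx r hr0]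
    linarith [hqneg r hr0]
  have hc := hqR.coeff_pos hqne
  rw [hqcard, Nat.add_sub_cancel] at hc
  set c := R.coeff n
  have hRnat : R.natDegree = n := by
    refine le_antisymm ?_ (le_natDegree_of_ne_zero hc.ne')
    have hR0 : R ≠ 0 := by rintro h0; simp [c, h0] at hc
    rw [degree_eq_natDegree hR0] at hRdeg
    have : R.natDegree < n + 1 := by exact_mod_cast hRdeg
    omega
  have hlead : R.leadingCoeff = c := by rw [leadingCoeff, hRnat]
  -- The remainder is `a ^ 2` times a monic polynomial, so `a ^ 2` must be its leading coefficient
  -- `c`, positive as a sum of weights.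
  refine ⟨Real.sqrt c, b, C c⁻¹ * R, Real.sqrt_pos.2 hc,
    ⟨h.monic_right, ?_, h.natDegree_right, ?_, hqcard', fun x hx => ?_⟩, ?_⟩
  · rw [Monic, leadingCoeff_mul, leadingCoeff_C, hlead, inv_mul_cancel₀ hc.ne']
  · rw [natDegree_C_mul (inv_ne_zero hc.ne'), hRnat]
  · rw [eval_mul, eval_C, hRx x hx]
    have h1 := hqneg x hx
    have h2 := inv_pos.2 hc
    nlinarith
  · rw [Real.sq_sqrt hc.le, ← mul_assoc, ← C_mul, mul_inv_cancel₀ hc.ne', hR]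
    simp

/-! ### Characteristic polynomials of Jacobi matrices and their perturbations -/

/-- Only two terms of the expansion along the first row survive, and the second minor has a single
nonzero candidate `M 1 0` in its first column. No symmetry is needed, so the perturbed matrix is
covered. -/
theorem Matrix.det_of_border {R : Type*} [CommRing R] {n : ℕ}
    (M : Matrix (Fin (n + 2)) (Fin (n + 2)) R) (hrow : ∀ j : Fin n, M 0 j.succ.succ = 0)
    (hcol : ∀ i : Fin n, M i.succ.succ 0 = 0) :
    M.det = M 0 0 * (M.submatrix Fin.succ Fin.succ).det -
      M 0 1 * M 1 0 *
        (M.submatrix (fun i : Fin n => i.succ.succ) fun i : Fin n => i.succ.succ).det := by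
  have h1 : (M.submatrix Fin.succ (Fin.succAbove 1)).det = M 1 0 *
      (M.submatrix (fun i : Fin n => i.succ.succ) fun i : Fin n => i.succ.succ).det := by
    rw [Matrix.det_succ_column_zero, Fin.sum_univ_succ, Finset.sum_eq_zero]
    · simp only [Matrix.submatrix_submatrix, Matrix.submatrix_apply]
      simp
      congr 2
    · intro i _
      simp [Matrix.submatrix_apply, hcol]
  rw [Matrix.det_succ_row_zero, Fin.sum_univ_succ, Fin.sum_univ_succ, Finset.sum_eq_zero]
  · have h2 : Fin.succ (0 : Fin (n + 1)) = 1 := rfl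
    rw [h2, h1]
    simp
    ring
  · intro j _
    simp [hrow]

theorem Matrix.charmatrix_submatrix_injective {R : Type*} [CommRing R] {m n : Type*}
    [Fintype m] [DecidableEq m] [Fintype n] [DecidableEq n] (M : Matrix n n R) {f : m → n}
    (hf : Function.Injective f) : (M.submatrix f f).charmatrix = M.charmatrix.submatrix f f := by
  ext i j : 2
  simp [Matrix.charmatrix_apply, Matrix.diagonal_apply, hf.eq_iff]

theorem Matrix.charpoly_of_border {R : Type*} [CommRing R] {n : ℕ}
    (M : Matrix (Fin (n + 2)) (Fin (n + 2)) R) (hrow : ∀ j : Fin n, M 0 j.succ.succ = 0)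
    (hcol : ∀ i : Fin n, M i.succ.succ 0 = 0) :
    M.charpoly = (X - C (M 0 0)) * (M.submatrix Fin.succ Fin.succ).charpoly -
      C (M 0 1 * M 1 0) *
        (M.submatrix (fun i : Fin n => i.succ.succ) fun i : Fin n => i.succ.succ).charpoly := by
  unfold Matrix.charpoly
  rw [Matrix.charmatrix_submatrix_injective M (Fin.succ_injective _),
    Matrix.charmatrix_submatrix_injective M (f := fun i : Fin n => i.succ.succ)
      ((Fin.succ_injective _).comp (Fin.succ_injective _)),
    Matrix.det_of_border]
  · rw [Matrix.charmatrix_apply_eq, Matrix.charmatrix_apply_ne _ _ _ Fin.zero_ne_one,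
      Matrix.charmatrix_apply_ne _ _ _ Fin.zero_ne_one.symm, C_mul, neg_mul_neg]
  · intro j
    rw [Matrix.charmatrix_apply_ne _ _ _ (Fin.succ_ne_zero _).symm, hrow]
    simp
  · intro j
    rw [Matrix.charmatrix_apply_ne _ _ _ (Fin.succ_ne_zero _), hcol]
    simp

/-- The characteristic polynomials of a Jacobi matrix and of the matrix obtained by deleting the
first row and column, through their recursion. -/
noncomputable def jacobiPair : (n : ℕ) → (Fin n → ℝ) → (Fin (n + 1) → ℝ) → ℝ[X] × ℝ[X]
  | 0, _, b => (X - C (b 0), 1)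
  | n + 1, a, b =>
    ((X - C (b 0)) * (jacobiPair n (Fin.tail a) (Fin.tail b)).1 -
      C (a 0 ^ 2) * (jacobiPair n (Fin.tail a) (Fin.tail b)).2,
      (jacobiPair n (Fin.tail a) (Fin.tail b)).1)

theorem jacobiMatrix_submatrix_succ {n : ℕ} (a : Fin (n + 1) → ℝ) (b : Fin (n + 2) → ℝ) :
    (jacobiMatrix a b).submatrix Fin.succ Fin.succ = jacobiMatrix (Fin.tail a) (Fin.tail b) := by
  ext i j
  simp only [jacobiMatrix, Matrix.submatrix_apply, Matrix.of_apply, Fin.succ_inj, Fin.val_succ,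
    add_left_inj, Fin.tail, Fin.succ_mk]

theorem jacobiMatrix_zero_zero {n : ℕ} (a : Fin n → ℝ) (b : Fin (n + 1) → ℝ) :
    jacobiMatrix a b 0 0 = b 0 := by
  simp [jacobiMatrix]

theorem jacobiMatrix_zero_one {n : ℕ} (a : Fin (n + 1) → ℝ) (b : Fin (n + 2) → ℝ) :
    jacobiMatrix a b 0 1 = a 0 := by
  simp [jacobiMatrix]

theorem jacobiMatrix_one_zero {n : ℕ} (a : Fin (n + 1) → ℝ) (b : Fin (n + 2) → ℝ) :
    jacobiMatrix a b 1 0 = a 0 := by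
  simp [jacobiMatrix]

theorem jacobiMatrix_zero_succ_succ {n : ℕ} (a : Fin (n + 1) → ℝ) (b : Fin (n + 2) → ℝ)
    (j : Fin n) : jacobiMatrix a b 0 j.succ.succ = 0 := by
  simp [jacobiMatrix, Fin.ext_iff]

theorem jacobiMatrix_succ_succ_zero {n : ℕ} (a : Fin (n + 1) → ℝ) (b : Fin (n + 2) → ℝ)
    (j : Fin n) : jacobiMatrix a b j.succ.succ 0 = 0 := by
  simp [jacobiMatrix, Fin.ext_iff]

theorem isHermitian_jacobiMatrix {n : ℕ} (a : Fin n → ℝ) (b : Fin (n + 1) → ℝ) :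
    (jacobiMatrix a b).IsHermitian := by
  ext i j
  simp only [jacobiMatrix, Matrix.conjTranspose_apply, Matrix.of_apply, star_trivial]
  rcases eq_or_ne i j with rfl | hij
  · rfl
  · rw [if_neg hij, if_neg hij.symm]
    split_ifs <;> first | rfl | omega

theorem charpoly_jacobiMatrix_pair {n : ℕ} (a : Fin n → ℝ) (b : Fin (n + 1) → ℝ) :
    (jacobiMatrix a b).charpoly = (jacobiPair n a b).1 ∧
      ((jacobiMatrix a b).submatrix Fin.succ Fin.succ).charpoly = (jacobiPair n a b).2 := by
  induction n with
  | zero =>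
    constructor
    · rw [Matrix.charpoly, Matrix.det_fin_one, Matrix.charmatrix_apply_eq, jacobiMatrix_zero_zero,
        jacobiPair]
    · rw [Matrix.charpoly, Matrix.det_fin_zero, jacobiPair]
  | succ n ih =>
    obtain ⟨ih1, ih2⟩ := ih (Fin.tail a) (Fin.tail b)
    rw [jacobiPair, jacobiMatrix_submatrix_succ, ih1]
    refine ⟨?_, rfl⟩
    rw [Matrix.charpoly_of_border _ (jacobiMatrix_zero_succ_succ a b)
      (jacobiMatrix_succ_succ_zero a b), jacobiMatrix_submatrix_succ, ih1, jacobiMatrix_zero_zero,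
      jacobiMatrix_zero_one, jacobiMatrix_one_zero, ← ih2, ← jacobiMatrix_submatrix_succ,
      Matrix.submatrix_submatrix, pow_two]
    rfl

theorem charpoly_jacobiMatrix {n : ℕ} (a : Fin n → ℝ) (b : Fin (n + 1) → ℝ) :
    (jacobiMatrix a b).charpoly = (jacobiPair n a b).1 :=
  (charpoly_jacobiMatrix_pair a b).1

theorem perturbedJacobi_submatrix {n m : ℕ} (a : Fin (n + 1) → ℝ) (b : Fin (n + 2) → ℝ) (l k : ℝ)
    {f : Fin m → Fin (n + 2)} (hf : ∀ i, f i ≠ 0) :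
    (perturbedJacobi a b l k).submatrix f f =
      ((jacobiMatrix a b).submatrix f f).map Complex.ofRealHom := by
  ext i j
  simp [perturbedJacobi, (hf j).symm]

theorem charpoly_perturbedJacobi {n : ℕ} (a : Fin (n + 1) → ℝ) (b : Fin (n + 2) → ℝ) (l m : ℝ) :
    (perturbedJacobi a b l m).charpoly =
      (jacobiPair (n + 1) a b).1.map Complex.ofRealHom -
        C Complex.I * (C l * (jacobiPair (n + 1) a b).2 +
          C (a 0 * m) * (jacobiPair n (Fin.tail a) (Fin.tail b)).2).map Complex.ofRealHom := by
  have hne : ∀ i : Fin n, i.succ.succ ≠ 0 := fun i => Fin.succ_ne_zero _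
  have h01 : (1 : Fin (n + 2)) ≠ 0 := Fin.zero_ne_one.symm
  obtain ⟨h1, h2⟩ := charpoly_jacobiMatrix_pair (Fin.tail a) (Fin.tail b)
  rw [Matrix.charpoly_of_border, perturbedJacobi_submatrix _ _ _ _ Fin.succ_ne_zero,
    perturbedJacobi_submatrix _ _ _ _ hne, Matrix.charpoly_map, Matrix.charpoly_map,
    jacobiMatrix_submatrix_succ, h1]
  · have h3 : (jacobiMatrix a b).submatrix (fun i : Fin n => i.succ.succ)
        (fun i : Fin n => i.succ.succ) =
        (jacobiMatrix (Fin.tail a) (Fin.tail b)).submatrix Fin.succ Fin.succ := by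
      rw [← jacobiMatrix_submatrix_succ, Matrix.submatrix_submatrix]
      rfl
    have e00 : perturbedJacobi a b l m 0 0 = b 0 + Complex.I * l := by
      simp [perturbedJacobi, jacobiMatrix_zero_zero, h01]
    have e01 : perturbedJacobi a b l m 0 1 = a 0 := by
      simp [perturbedJacobi, jacobiMatrix_zero_one, h01.symm]
    have e10 : perturbedJacobi a b l m 1 0 = a 0 + Complex.I * m := by
      simp [perturbedJacobi, jacobiMatrix_one_zero, h01.symm]
    rw [h3, h2, e00, e01, e10, jacobiPair]
    simp
    ring
  · intro j
    have : (0 : Fin (n + 2)) ≠ j.succ.succ := (hne j).symm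
    simp [perturbedJacobi, jacobiMatrix_zero_succ_succ, this]
  · intro j
    have h1 : (1 : Fin (n + 2)) ≠ j.succ.succ := fun h => by
      simp [Fin.ext_iff] at h
    simp [perturbedJacobi, jacobiMatrix_succ_succ_zero, (hne j).symm, h1]

/-! ### Jacobi matrices correspond to interlacing pairs -/

theorem jacobiPair_natDegree {n : ℕ} (a : Fin n → ℝ) (b : Fin (n + 1) → ℝ) :
    (jacobiPair n a b).1.Monic ∧ (jacobiPair n a b).1.natDegree = n + 1 ∧
      (jacobiPair n a b).2.Monic ∧ (jacobiPair n a b).2.natDegree = n := by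
  have h1 : (jacobiPair n a b).1.Monic ∧ (jacobiPair n a b).1.natDegree = n + 1 := by
    rw [← charpoly_jacobiMatrix]
    exact ⟨Matrix.charpoly_monic _, by rw [Matrix.charpoly_natDegree_eq_dim, Fintype.card_fin]⟩
  have h2 : (jacobiPair n a b).2.Monic ∧ (jacobiPair n a b).2.natDegree = n := by
    rw [← (charpoly_jacobiMatrix_pair a b).2]
    exact ⟨Matrix.charpoly_monic _, by rw [Matrix.charpoly_natDegree_eq_dim, Fintype.card_fin]⟩
  exact ⟨h1.1, h1.2, h2.1, h2.2⟩

/-- By the recursion, the Wronskian at size `n + 1` is `p ^ 2 + a 0 ^ 2 * W`, with `p` and `W` the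
polynomial and Wronskian of the truncated data. -/
theorem jacobiPair_wronskian_pos {n : ℕ} {a : Fin n → ℝ} (ha : ∀ i, 0 < a i) (b : Fin (n + 1) → ℝ) (x : ℝ) :
    0 < (jacobiPair n a b).1.derivative.eval x * (jacobiPair n a b).2.eval x -
      (jacobiPair n a b).1.eval x * (jacobiPair n a b).2.derivative.eval x := by
  induction n with
  | zero => simp [jacobiPair]
  | succ n ih =>
    have h1 := ih (a := Fin.tail a) (fun i => ha i.succ) (Fin.tail b)
    rw [jacobiPair]
    simp only [derivative_sub, derivative_mul, derivative_X, derivative_C, eval_sub, eval_mul,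
      eval_add, eval_X, eval_C, eval_one, eval_zero]
    nlinarith [mul_pos (pow_pos (ha 0) 2) h1,
      sq_nonneg ((jacobiPair n (Fin.tail a) (Fin.tail b)).1.eval x)]

theorem interlaces_jacobiPair {n : ℕ} {a : Fin n → ℝ} (ha : ∀ i, 0 < a i) (b : Fin (n + 1) → ℝ) :
    Interlaces n (jacobiPair n a b).1 (jacobiPair n a b).2 := by
  obtain ⟨h1, h2, h3, h4⟩ := jacobiPair_natDegree a b
  refine ⟨h1, h3, h2, h4, ?_, fun x hx => ?_⟩
  · rw [← h2, ← charpoly_jacobiMatrix]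
    exact splits_iff_card_roots.1 (isHermitian_jacobiMatrix a b).splits_charpoly
  · have := jacobiPair_wronskian_pos ha b x
    rw [hx, zero_mul, sub_zero] at this
    exact this

theorem exists_jacobiPair_eq {n : ℕ} {p q : ℝ[X]} (h : Interlaces n p q) :
    ∃ (a : Fin n → ℝ) (b : Fin (n + 1) → ℝ), (∀ i, 0 < a i) ∧ jacobiPair n a b = (p, q) := by
  induction n generalizing p q with
  | zero =>
    have hq : q = 1 := eq_one_of_monic_natDegree_zero h.monic_right h.natDegree_right
    have hp : p = X + C (p.coeff 0) := by
      conv_lhs => rw [eq_X_add_C_of_natDegree_le_one h.natDegree_left.le]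
      have : p.coeff 1 = 1 := by
        have := h.monic_left
        rwa [Monic, leadingCoeff, h.natDegree_left] at this
      rw [this, C_1, one_mul]
    refine ⟨fun i => i.elim0, fun _ => -p.coeff 0, fun i => i.elim0, ?_⟩
    rw [jacobiPair, hq, C_neg, sub_neg_eq_add, ← hp]
  | succ n ih =>
    obtain ⟨a₀, b₀, r, ha₀, hr, hp⟩ := h.exists_step
    obtain ⟨a, b, ha, hab⟩ := ih hr
    refine ⟨Fin.cons a₀ a, Fin.cons b₀ b, fun i => ?_, ?_⟩
    · refine Fin.cases ?_ (fun j => ?_) i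
      · simpa using ha₀
      · simpa using ha j
    · rw [jacobiPair]
      simp [hab, hp]

theorem jacobiPair_injective {n : ℕ} {a a' : Fin n → ℝ} {b b' : Fin (n + 1) → ℝ}
    (ha : ∀ i, 0 < a i) (ha' : ∀ i, 0 < a' i) (h : jacobiPair n a b = jacobiPair n a' b') :
    a = a' ∧ b = b' := by
  induction n with
  | zero =>
    refine ⟨funext fun i => i.elim0, funext fun i => ?_⟩
    have h1 := congrArg (fun p => p.1.eval 0) h
    rw [Fin.fin_one_eq_zero i]
    simpa [jacobiPair] using h1
  | succ n ih =>
    rw [jacobiPair, jacobiPair, Prod.mk.injEq] at h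
    obtain ⟨h1, h2⟩ := h
    obtain ⟨-, hq1, -, -⟩ := jacobiPair_natDegree (Fin.tail a) (Fin.tail b)
    obtain ⟨hqm, -, hrm, hr⟩ := jacobiPair_natDegree (Fin.tail a) (Fin.tail b)
    obtain ⟨-, -, hrm', hr'⟩ := jacobiPair_natDegree (Fin.tail a') (Fin.tail b')
    rw [← h2] at h1
    have hqc : (jacobiPair n (Fin.tail a) (Fin.tail b)).1.coeff (n + 1) = 1 := by
      rwa [Monic, leadingCoeff, hq1] at hqm
    have hrc : (jacobiPair n (Fin.tail a) (Fin.tail b)).2.coeff n = 1 := by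
      rwa [Monic, leadingCoeff, hr] at hrm
    have hrc' : (jacobiPair n (Fin.tail a') (Fin.tail b')).2.coeff n = 1 := by
      rwa [Monic, leadingCoeff, hr'] at hrm'
    have hrz : (jacobiPair n (Fin.tail a) (Fin.tail b)).2.coeff (n + 1) = 0 :=
      coeff_eq_zero_of_natDegree_lt (by omega)
    have hrz' : (jacobiPair n (Fin.tail a') (Fin.tail b')).2.coeff (n + 1) = 0 :=
      coeff_eq_zero_of_natDegree_lt (by omega)
    -- The two remainders have degree `n`, so the coefficient of degree `n + 1` sees only `b 0`; the
    -- next one then gives `a 0 ^ 2`.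
    have hb : b 0 = b' 0 := by
      have := congrArg (fun p => p.coeff (n + 1)) h1
      simp only [coeff_sub, sub_mul, coeff_X_mul, coeff_C_mul, hqc, hrz, hrz'] at this
      linarith
    rw [hb, sub_right_inj] at h1
    have ha2 : a 0 ^ 2 = a' 0 ^ 2 := by
      have := congrArg (fun p => p.coeff n) h1
      simpa only [coeff_C_mul, hrc, hrc', mul_one] using this
    have ha0 : a 0 = a' 0 := (pow_left_inj₀ (ha 0).le (ha' 0).le two_ne_zero).1 ha2
    rw [ha2] at h1
    have h3 := mul_left_cancel₀ (C_ne_zero.2 (pow_ne_zero 2 (ha' 0).ne')) h1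
    obtain ⟨hta, htb⟩ := ih (a := Fin.tail a) (a' := Fin.tail a') (fun i => ha i.succ)
      (fun i => ha' i.succ) (Prod.ext h2 h3)
    exact ⟨by rw [← Fin.cons_self_tail a, ← Fin.cons_self_tail a', ha0, hta],
      by rw [← Fin.cons_self_tail b, ← Fin.cons_self_tail b', hb, htb]⟩

/-! ### Splitting a complex polynomial into real and imaginary parts -/

theorem exists_re_im_polynomial (P : ℂ[X]) :
    ∃ A B : ℝ[X], P = A.map Complex.ofRealHom + C Complex.I * B.map Complex.ofRealHom := by
  induction P using Polynomial.induction_on' with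
  | add P Q hP hQ =>
    obtain ⟨A, B, rfl⟩ := hP
    obtain ⟨A', B', rfl⟩ := hQ
    exact ⟨A + A', B + B', by simp only [Polynomial.map_add]; ring⟩
  | monomial i c =>
    refine ⟨monomial i c.re, monomial i c.im, ?_⟩
    rw [map_monomial, map_monomial, C_mul_monomial, ← map_add,
      Complex.ofRealHom_eq_coe, Complex.ofRealHom_eq_coe, mul_comm, Complex.re_add_im]

theorem re_coeff {A B : ℝ[X]} (i : ℕ) :
    ((A.map Complex.ofRealHom + C Complex.I * B.map Complex.ofRealHom).coeff i).re =
      A.coeff i := by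
  simp [coeff_map]

theorem im_coeff {A B : ℝ[X]} (i : ℕ) :
    ((A.map Complex.ofRealHom + C Complex.I * B.map Complex.ofRealHom).coeff i).im =
      B.coeff i := by
  simp [coeff_map]

theorem re_im_polynomial_unique {A B A' B' : ℝ[X]}
    (h : A.map Complex.ofRealHom + C Complex.I * B.map Complex.ofRealHom =
      A'.map Complex.ofRealHom + C Complex.I * B'.map Complex.ofRealHom) : A = A' ∧ B = B' := by
  constructor <;> ext i
  · rw [← re_coeff (A := A) (B := B), h, re_coeff]
  · rw [← im_coeff (A := A) (B := B), h, im_coeff]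

theorem isReImPair_of_prod_eq {s : Multiset ℂ} {A B : ℝ[X]}
    (h : (s.map fun z => X - C z).prod =
      A.map Complex.ofRealHom + C Complex.I * B.map Complex.ofRealHom) : IsReImPair s A B := by
  intro x
  have h1 := congrArg (eval (x : ℂ)) h
  have h2 : ∀ D : ℝ[X], eval (x : ℂ) (D.map Complex.ofRealHom) = ((D.eval x : ℝ) : ℂ) := fun D =>
    eval_map_apply Complex.ofRealHom x
  rw [eval_multiset_prod, Multiset.map_map, eval_add, eval_mul, eval_C, h2, h2] at h1
  rw [mul_comm _ Complex.I, ← h1]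
  simp

theorem prod_eigenvalueMultiset {n : ℕ} (M : Matrix (Fin n) (Fin n) ℂ) :
    ((eigenvalueMultiset M).map fun z => X - C z).prod = M.charpoly := by
  have h := (IsAlgClosed.splits M.charpoly).eq_prod_roots
  rw [M.charpoly_monic.leadingCoeff, C_1, one_mul] at h
  exact h.symm

theorem card_eigenvalueMultiset {n : ℕ} (M : Matrix (Fin n) (Fin n) ℂ) :
    Multiset.card (eigenvalueMultiset M) = n := by
  rw [eigenvalueMultiset, ← (IsAlgClosed.splits M.charpoly).natDegree_eq_card_roots,
    Matrix.charpoly_natDegree_eq_dim, Fintype.card_fin]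

theorem eval_charpoly_ne_zero_iff {n : ℕ} (M : Matrix (Fin n) (Fin n) ℝ) (ξ : ℝ) :
    M.charpoly.eval ξ ≠ 0 ↔ (M - ξ • (1 : Matrix (Fin n) (Fin n) ℝ)).det ≠ 0 := by
  have h : (Matrix.scalar (Fin n)) ξ - M = -(M - ξ • (1 : Matrix (Fin n) (Fin n) ℝ)) := by
    rw [neg_sub, Matrix.smul_one_eq_diagonal, Matrix.scalar_apply]
  rw [Matrix.eval_charpoly, h, Matrix.det_neg, mul_ne_zero_iff,
    and_iff_right (pow_ne_zero _ (by norm_num))]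

/-! ### The direct and the inverse problem -/

/-- The characteristic polynomial of the perturbed matrix in terms of the ratio `m / a 0` and the
point `ξ`. -/
theorem charpoly_perturbedJacobi_eq {n : ℕ} {a : Fin (n + 1) → ℝ} {b : Fin (n + 2) → ℝ}
    {l m ξ : ℝ} (ha : a 0 ≠ 0) (hm : m ≠ 0) (hξ : ξ = b 0 - l * a 0 / m) :
    (perturbedJacobi a b l m).charpoly = (jacobiPair (n + 1) a b).1.map Complex.ofRealHom +
      C Complex.I * (C (m / a 0) * ((jacobiPair (n + 1) a b).1 -
        (X - C ξ) * (jacobiPair (n + 1) a b).2)).map Complex.ofRealHom := by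
  -- The recursion replaces `a 0 ^ 2` times the second truncation by `(X - b 0) q - p`; the
  -- remaining multiple of `q` combines into `X - ξ`.
  have key : C (m / a 0) * ((jacobiPair (n + 1) a b).1 - (X - C ξ) * (jacobiPair (n + 1) a b).2) =
      -(C l * (jacobiPair (n + 1) a b).2 +
        C (a 0 * m) * (jacobiPair n (Fin.tail a) (Fin.tail b)).2) := by
    have h1 : m / a 0 * (b 0 - ξ) = l := by rw [hξ]; field_simp; ring
    have h2 : m / a 0 * a 0 ^ 2 = a 0 * m := by field_simp
    have h3 : C l = C (m / a 0) * (C (b 0) - C ξ) := by rw [← C_sub, ← C_mul, h1]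
    rw [jacobiPair, ← h2, C_mul (a := m / a 0) (b := a 0 ^ 2), h3]
    ring
  rw [charpoly_perturbedJacobi, key, Polynomial.map_neg, mul_neg, sub_eq_add_neg]

theorem perturbedJacobi_spectrum {n : ℕ} {a : Fin (n + 1) → ℝ} {b : Fin (n + 2) → ℝ} {l m ξ : ℝ}
    (ha : ∀ i, 0 < a i) (hm : 0 < m) (hξ : ξ = b 0 - l * a 0 / m)
    (hdet : (jacobiMatrix a b - ξ • (1 : Matrix (Fin (n + 2)) (Fin (n + 2)) ℝ)).det ≠ 0) :
    eigenvalueMultiset (perturbedJacobi a b l m) ∈ admissibleConfigurations (n + 2) ξ ∧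
      (eigenvalueMultiset (jacobiMatrix a b)).countP (fun x => ξ < x) =
        (eigenvalueMultiset (perturbedJacobi a b l m)).countP (fun z => 0 < z.im) ∧
      (eigenvalueMultiset (jacobiMatrix a b)).countP (fun x => x < ξ) =
        (eigenvalueMultiset (perturbedJacobi a b l m)).countP (fun z => z.im < 0) := by
  have hP := charpoly_perturbedJacobi_eq (b := b) (ha 0).ne' hm.ne' hξ
  have hI := interlaces_jacobiPair ha b
  rw [← eval_charpoly_ne_zero_iff, charpoly_jacobiMatrix] at hdet
  have hk : 0 < m / a 0 := div_pos hm (ha 0)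
  have hcard := card_eigenvalueMultiset (perturbedJacobi a b l m)
  have hprod := prod_eigenvalueMultiset (perturbedJacobi a b l m)
  rw [hP] at hprod
  have hJ : eigenvalueMultiset (jacobiMatrix a b) = (jacobiPair (n + 1) a b).1.roots := by
    rw [eigenvalueMultiset, charpoly_jacobiMatrix]
  rw [hJ]
  have hpair := isReImPair_of_prod_eq hprod
  generalize eigenvalueMultiset (perturbedJacobi a b l m) = s at *
  set p := (jacobiPair (n + 1) a b).1
  set q := (jacobiPair (n + 1) a b).2
  have hB : ∀ x, (C (m / a 0) * (p - (X - C ξ) * q)).eval x =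
      m / a 0 * (p.eval x - (x - ξ) * q.eval x) := fun x => by simp
  have hp0 : p ≠ 0 := hI.monic_left.ne_zero
  have hq : ∀ x, p.eval x = 0 → p.derivative.eval x ≠ 0 ∧ q.eval x ≠ 0 := fun x hx =>
    mul_ne_zero_iff.1 (hI.pos x hx).ne'
  have hne : ∀ x, p.eval x = 0 → x ≠ ξ := by
    rintro x hx rfl
    exact hdet hx
  -- A real eigenvalue would be a common zero of `p` and `p - (X - ξ) q`, but neither `q` nor `X -
  -- ξ` vanishes at a root of `p`.
  have hs : ∀ z ∈ s, z.im ≠ 0 := by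
    intro z hz him
    have hzx : z = (z.re : ℂ) := Complex.ext rfl (by simpa using him)
    have h0 := hpair z.re
    rw [← hzx, Multiset.prod_eq_zero (Multiset.mem_map.2 ⟨z, hz, sub_self z⟩)] at h0
    have hre := congrArg Complex.re h0
    have him := congrArg Complex.im h0
    simp only [Complex.zero_re, Complex.zero_im, Complex.add_re, Complex.add_im, Complex.mul_re,
      Complex.mul_im, Complex.ofReal_re, Complex.ofReal_im, Complex.I_re, Complex.I_im, mul_zero,
      mul_one, add_zero, zero_add, sub_zero] at hre him
    rw [hB, ← hre, zero_sub, mul_neg, zero_eq_neg] at him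
    exact mul_ne_zero hk.ne' (mul_ne_zero (sub_ne_zero.2 (hne _ hre.symm)) (hq _ hre.symm).2) him
  have hs0 : s ≠ 0 := by
    rintro rfl
    simp at hcard
  obtain ⟨h1, h2, h3⟩ := hpair.count_of_sign (ξ := ξ) hs hs0 (by rw [hI.card_roots, hcard])
    (nodup_roots_of_derivative_ne_zero hp0 fun x hx => (hq x hx).1) hdet (fun r hr => by
      have h1 := hI.pos r hr
      have h2 : 0 < (r - ξ) ^ 2 := by have := sub_ne_zero.2 (hne r hr); positivity
      rw [hB, hr]
      nlinarith [mul_pos (mul_pos h1 h2) hk])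
  exact ⟨⟨hcard, hs, h1⟩, h2, h3⟩

theorem perturbedJacobi_parameters_unique {n : ℕ} {a a' : Fin (n + 1) → ℝ} {b b' : Fin (n + 2) → ℝ}
    {l m l' m' ξ : ℝ} (ha : ∀ i, 0 < a i) (hm : 0 < m) (hξ : ξ = b 0 - l * a 0 / m)
    (ha' : ∀ i, 0 < a' i) (hm' : 0 < m') (hξ' : ξ = b' 0 - l' * a' 0 / m')
    (hdet : (jacobiMatrix a b - ξ • (1 : Matrix (Fin (n + 2)) (Fin (n + 2)) ℝ)).det ≠ 0)
    (h : eigenvalueMultiset (perturbedJacobi a' b' l' m') =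
      eigenvalueMultiset (perturbedJacobi a b l m)) :
    a' = a ∧ b' = b ∧ l' = l ∧ m' = m := by
  have hchar : (perturbedJacobi a' b' l' m').charpoly = (perturbedJacobi a b l m).charpoly := by
    rw [← prod_eigenvalueMultiset, h, prod_eigenvalueMultiset]
  rw [charpoly_perturbedJacobi_eq (ha 0).ne' hm.ne' hξ,
    charpoly_perturbedJacobi_eq (ha' 0).ne' hm'.ne' hξ'] at hchar
  obtain ⟨hp, hB⟩ := re_im_polynomial_unique hchar
  rw [← eval_charpoly_ne_zero_iff, charpoly_jacobiMatrix] at hdet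
  rw [hp] at hB
  -- At `ξ` the term with `q` drops out, leaving the ratio of imaginary to real part.
  have hk : m' / a' 0 = m / a 0 := by
    have := congrArg (eval ξ) hB
    simp only [eval_mul, eval_sub, eval_C, eval_X, sub_self, zero_mul, sub_zero] at this
    exact mul_right_cancel₀ hdet this
  rw [hk] at hB
  have h1 := mul_left_cancel₀ (C_ne_zero.2 (div_pos hm (ha 0)).ne') hB
  have hq := mul_left_cancel₀ (X_sub_C_ne_zero ξ) (sub_right_inj.1 h1)
  obtain ⟨rfl, rfl⟩ := jacobiPair_injective ha' ha (Prod.ext hp hq)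
  have hmm : m' = m := by
    rwa [div_left_inj' (ha 0).ne'] at hk
  subst hmm
  refine ⟨rfl, rfl, ?_, rfl⟩
  have h2 : l' * a' 0 / m' = l * a' 0 / m' := by linarith
  rw [div_left_inj' hm.ne'] at h2
  exact mul_right_cancel₀ (ha 0).ne' h2

theorem exists_perturbedJacobi {n : ℕ} {ξ : ℝ} {s : Multiset ℂ}
    (h : s ∈ admissibleConfigurations (n + 2) ξ) :
    ∃ (a : Fin (n + 1) → ℝ) (b : Fin (n + 2) → ℝ) (l m : ℝ),
      (∀ i, 0 < a i) ∧ 0 < m ∧ ξ = b 0 - l * a 0 / m ∧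
        (jacobiMatrix a b - ξ • (1 : Matrix (Fin (n + 2)) (Fin (n + 2)) ℝ)).det ≠ 0 ∧
        eigenvalueMultiset (perturbedJacobi a b l m) = s := by
  obtain ⟨hcard, hs, hS⟩ := h
  have hs0 : s ≠ 0 := by
    rintro rfl
    simp at hcard
  have hPm : (s.map fun z => X - C z).prod.Monic := monic_multisetProd_X_sub_C s
  have hPd : (s.map fun z => X - C z).prod.natDegree = n + 2 := by
    rw [natDegree_multiset_prod_X_sub_C_eq_card, hcard]
  obtain ⟨A, B, hAB⟩ := exists_re_im_polynomial (s.map fun z => X - C z).prod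
  have hpair := isReImPair_of_prod_eq hAB
  have hlead : (s.map fun z => X - C z).prod.coeff (n + 2) = 1 := by
    rwa [Monic, leadingCoeff, hPd] at hPm
  have hhigh : ∀ i, n + 2 < i → (s.map fun z => X - C z).prod.coeff i = 0 := fun i hi =>
    coeff_eq_zero_of_natDegree_lt (by rwa [hPd])
  have hAle : A.natDegree ≤ n + 2 := natDegree_le_iff_coeff_eq_zero.2 fun i hi => by
    rw [← re_coeff (B := B), ← hAB, hhigh i hi, Complex.zero_re]
  have hAc : A.coeff (n + 2) = 1 := by
    rw [← re_coeff (B := B), ← hAB, hlead, Complex.one_re]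
  have hAm : A.Monic := monic_of_natDegree_le_of_coeff_eq_one _ hAle hAc
  have hAd : A.natDegree = n + 2 :=
    le_antisymm hAle (le_natDegree_of_ne_zero (by rw [hAc]; exact one_ne_zero))
  have hBd : B.degree < ((n + 2 : ℕ) : WithBot ℕ) := by
    rw [degree_lt_iff_coeff_zero]
    intro i hi
    rw [← im_coeff (A := A), ← hAB]
    rcases hi.eq_or_lt with rfl | hi
    · rw [hlead, Complex.one_im]
    · rw [hhigh i hi, Complex.zero_im]
  obtain ⟨hnd, hroots, hsign⟩ := hpair.sign_of_sum_lt hs hAm.ne_zero (by rw [hAd, hcard]) hS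
  have hξ := hpair.eval_mul_pos hs hs0 hS
  have hA0 : A.eval ξ ≠ 0 := left_ne_zero_of_mul hξ.ne'
  -- The only possible value of `m / a 0`; with it `A - k⁻¹ B` vanishes at `ξ`, and its quotient by
  -- `X - ξ` is the candidate for `q`.
  set k : ℝ := B.eval ξ / A.eval ξ with hk
  have hkpos : 0 < k := div_pos_iff.2 (mul_pos_iff.1 (mul_comm _ (B.eval ξ) ▸ hξ))
  set R : ℝ[X] := A - C k⁻¹ * B with hR
  have hBd' : (C k⁻¹ * B).degree < A.degree := by
    rw [degree_C_mul (inv_ne_zero hkpos.ne'), degree_eq_natDegree hAm.ne_zero, hAd]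
    exact hBd
  have hRm : R.Monic := hAm.sub_of_left hBd'
  have hRd : R.natDegree = n + 2 := by
    rw [← hAd]
    exact natDegree_eq_of_degree_eq (degree_sub_eq_left_of_degree_lt hBd')
  have hRξ : R.IsRoot ξ := by
    have hB0 : B.eval ξ ≠ 0 := right_ne_zero_of_mul hξ.ne'
    rw [IsRoot.def, hR, eval_sub, eval_mul, eval_C, hk]
    field_simp
    ring
  obtain ⟨q, hq⟩ := dvd_iff_isRoot.2 hRξ
  have hqm : q.Monic := (monic_X_sub_C ξ).of_mul_monic_left (hq ▸ hRm)
  have hqd : q.natDegree = n + 1 := by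
    have := (monic_X_sub_C ξ).natDegree_mul hqm
    rw [← hq, hRd, natDegree_X_sub_C] at this
    omega
  have hI : Interlaces (n + 1) A q := by
    refine ⟨hAm, hqm, hAd, hqd, by rw [hroots, hcard], fun r hr => ?_⟩
    have hrξ : r - ξ ≠ 0 := by
      rw [sub_ne_zero]
      rintro rfl
      exact hA0 hr
    have h1 : -(k⁻¹ * B.eval r) = (r - ξ) * q.eval r := by
      have := congrArg (eval r) hq
      simpa [hR, hr] using this
    have h2 : A.derivative.eval r * q.eval r * (r - ξ) ^ 2 =
        k⁻¹ * -(A.derivative.eval r * B.eval r * (r - ξ)) := by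
      linear_combination (-(A.derivative.eval r) * (r - ξ)) * h1
    have h3 : 0 < A.derivative.eval r * q.eval r * (r - ξ) ^ 2 := by
      rw [h2]
      exact mul_pos (inv_pos.2 hkpos) (neg_pos.2 (hsign r hr))
    exact pos_of_mul_pos_left h3 (sq_nonneg _)
  obtain ⟨a, b, ha, hab⟩ := exists_jacobiPair_eq hI
  have ha0 := ha 0
  have hξl : ξ = b 0 - k * (b 0 - ξ) * a 0 / (k * a 0) := by
    field_simp
    ring
  -- Solves `m / a 0 = k` and `b 0 - l * a 0 / m = ξ` for `m` and `l`.
  refine ⟨a, b, k * (b 0 - ξ), k * a 0, ha, mul_pos hkpos ha0, hξl, ?_, ?_⟩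
  · rw [← eval_charpoly_ne_zero_iff, charpoly_jacobiMatrix, hab]
    exact hA0
  · have hB : C (k * a 0 / a 0) * (A - (X - C ξ) * q) = B := by
      rw [← hq, hR, mul_div_assoc, div_self ha0.ne', mul_one, sub_sub_cancel, ← mul_assoc, ← C_mul,
        mul_inv_cancel₀ hkpos.ne', C_1, one_mul]
    rw [eigenvalueMultiset, charpoly_perturbedJacobi_eq ha0.ne' (mul_pos hkpos ha0).ne' hξl, hab,
      hB, ← hAB, roots_multiset_prod_X_sub_C]

theorem theorem5p3 (n : ℕ) :
    -- The direct problem, for matrices of size `n + 2`.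
    (∀ (a : Fin (n + 1) → ℝ) (b : Fin (n + 2) → ℝ) (l m ξ : ℝ),
      (∀ i, 0 < a i) → 0 < m → ξ = b 0 - l * a 0 / m →
      (jacobiMatrix a b - ξ • (1 : Matrix (Fin (n + 2)) (Fin (n + 2)) ℝ)).det ≠ 0 →
        eigenvalueMultiset (perturbedJacobi a b l m) ∈ admissibleConfigurations (n + 2) ξ ∧
        (eigenvalueMultiset (jacobiMatrix a b)).countP (fun x => ξ < x) =
          (eigenvalueMultiset (perturbedJacobi a b l m)).countP (fun z => 0 < z.im) ∧
        (eigenvalueMultiset (jacobiMatrix a b)).countP (fun x => x < ξ) =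
          (eigenvalueMultiset (perturbedJacobi a b l m)).countP (fun z => z.im < 0)) ∧
    -- The inverse problem: existence, and uniqueness of all the parameters.
    (∀ (ξ : ℝ) (s : Multiset ℂ), s ∈ admissibleConfigurations (n + 2) ξ →
      ∃ (a : Fin (n + 1) → ℝ) (b : Fin (n + 2) → ℝ) (l m : ℝ),
        ((∀ i, 0 < a i) ∧ 0 < m ∧ ξ = b 0 - l * a 0 / m ∧
          (jacobiMatrix a b - ξ • (1 : Matrix (Fin (n + 2)) (Fin (n + 2)) ℝ)).det ≠ 0 ∧
          eigenvalueMultiset (perturbedJacobi a b l m) = s) ∧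
        ∀ (a' : Fin (n + 1) → ℝ) (b' : Fin (n + 2) → ℝ) (l' m' : ℝ),
          (∀ i, 0 < a' i) → 0 < m' → ξ = b' 0 - l' * a' 0 / m' →
          eigenvalueMultiset (perturbedJacobi a' b' l' m') = s →
            a' = a ∧ b' = b ∧ l' = l ∧ m' = m) := by
  refine ⟨fun a b l m ξ ha hm hξ hdet => perturbedJacobi_spectrum ha hm hξ hdet, fun ξ s hs => ?_⟩
  obtain ⟨a, b, l, m, ha, hm, hξ, hdet, rfl⟩ := exists_perturbedJacobi hs
  exact ⟨a, b, l, m, ⟨ha, hm, hξ, hdet, rfl⟩, fun a' b' l' m' ha' hm' hξ' h =>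
    perturbedJacobi_parameters_unique ha hm hξ ha' hm' hξ' hdet h⟩
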